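/- **Setting.** Let $\Omega\subset\mathbb R^d$ be compact, equipped with an intrinsic metric $\mathsf d$ that induces the usual topology of $\Omega$; put $B(x,r)=\{y\in\Omega:\mathsf d(x,y)<r\}$. Let $\mathsf m$ be a finite Borel measure on $\Omega$ (typically Lebesgue or surface measure) that is doubling, $\mathsf m(B(x,2r))\le c\,\mathsf m(B(x,r))$ for all $x\in\Omega$, $r>0$, and satisfies $\inf_{x}\mathsf m(B(x,\varepsilon))>0$ for every $\varepsilon>0$. For an integrable $\mathsf w\ge0$ on $\Omega$ write $\mathsf w(E)=\int_E\mathsf w\,d\mathsf m$; $\mathsf w$ is a *doubling weight* if $\mathsf w(B(x,2r))\le L\,\mathsf w(B(x,r))$ for all $x\in\Omega$, $r>0$, with some constant $L$. Let $\Pi_n(\Omega)$ be the space of restrictions to $\Omega$ of real polynomials of degree at most $n$. For a doubling weight $\mathsf w$ with $\mathsf w(\Omega)=1$, let $\langle f,g\rangle_{\mathsf w}=\int_\Omega fg\,\mathsf w\,d\mathsf m$, let $\mathcal V_n(\Omega,\mathsf w)$ be the space of those elements of $\Pi_n(\Omega)$ that are orthogonal to all polynomials of degree less than $n$, and let $P_n(\mathsf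 w;\cdot,\cdot)$ be its reproducing kernel. An *admissible cut-off function* is a nonnegative $\widehat a\in C^\infty([0,\infty))$ with either (a) $\operatorname{supp}\widehat a\subset[0,2]$ and $\widehat a=1$ on $[0,1]$, or (b) $\operatorname{supp}\widehat a\subset[1/2,2]$. For $n\ge1$ put $$L_n(\mathsf w;x,y)=\sum_{k=0}^\infty\widehat a(k/n)\,P_k(\mathsf w;x,y).$$ The space $(\Omega,\varpi,\mathsf d)$ is *localizable* if $\varpi$ is a doubling weight with $\varpi(\Omega)=1$ such that, for every admissible cut-off function, with constants independent of $n\ge1$ and of the points of $\Omega$: 1. for every $\kappa>0$, $\displaystyle |L_n(\varpi;x,y)|\le \frac{c_\kappa}{\sqrt{\varpi(B(x,\frac1n))}\sqrt{\varpi(B(y,\frac1n))}\,(1+n\mathsf d(x,y))^{\kappa}}$; 2. there is $\delta_*\in(0,1)$ such that for every $\kappa>0$, every $0<\delta\le\delta_*$ and $x_1\in B(x_2,\frac\delta n)$, $\displaystyle |L_n(\varpi;x_1,y)-L_n(\varpi;x_2,y)|\le \frac{c_\kappa\, n\,\mathsf d(x_1,x_2)}{\sqrt{\varpi(B(x_1,\frac1n))}\sqrt{\varpi(B(x_2,\frac1n))}\,(1+n\mathsf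 d(x_2,y))^{\kappa}}$; 3. for all sufficiently large $\kappa$, $\displaystyle\int_\Omega\frac{\varpi(y)}{\varpi(B(y,\frac1n))(1+n\mathsf d(x,y))^\kappa}\,d\mathsf m(y)\le c_\kappa$. *Assertion 4* (existence of fast decaying polynomials) says: for each $\gamma>1$ there are constants $\delta',c_\gamma,c_1',c_2'>0$ and an integer $r\ge1$ such that for each $n\ge1$ there are polynomials $T_x\in\Pi_n(\Omega)$, $x\in\Omega$, and a polynomial $q_n$ with: $T_x(x)=1$; $T_x\ge\delta'$ on $B(x,\frac1n)$; $0\le T_x(y)\le c_\gamma(1+n\mathsf d(x,y))^{-\gamma}$ on $\Omega$; $c_1'\le q_n\le c_2'$ on $\Omega$; and, for each $y\in\Omega$, $x\mapsto q_n(x)T_x(y)$ belongs to $\Pi_{rn}(\Omega)$. A set $\Xi\subset\Omega$ is *maximal $\varepsilon$-separated* if $\mathsf d(x,y)\ge\varepsilon$ for distinct $x,y\in\Xi$ and there is a constant $c>1$ with $1\le\sum_{z\in\Xi}\chi_{B(z,\varepsilon)}(x)\le c$ for all $x\in\Omega$. (Such sets are finite.) **Theorem.** Assume that $(\Omega,\varpi,\mathsf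 d)$ is localizable and that Assertion 4 holds, and let $\mathsf w$ be a doubling weight on $\Omega$, normalized by $\mathsf w(\Omega)=1$. There is $\delta_0>0$ such that for every $0<\delta<\delta_0$ there are constants $c_1,c_2>0$ for which the following holds. Let $\Xi_j$ be a maximal $\delta2^{-j}$-separated subset of $\Omega$ for $j=0,1,2,\dots$. (i) There are $\lambda_{z,j}>0$, $z\in\Xi_j$, $j\ge 0$, such that $$\int_\Omega f\,\mathsf w\,d\mathsf m=\sum_{z\in\Xi_j}\lambda_{z,j}f(z)\quad\text{for all } f\in\Pi_{2^{j+1}}(\Omega),\qquad(*)$$ and $c_1\mathsf w(B(z,2^{-j}))\le\lambda_{z,j}\le c_2\mathsf w(B(z,2^{-j}))$. (ii) Let $\lambda_{z,j}>0$ be any weights satisfying $(*)$ for all $j\ge 0$, and let $0\le\widehat a\in C^\infty(\mathbb R)$ satisfy $\operatorname{supp}\widehat a\subset[\frac12,2]$, $\widehat a\ge\rho>0$ on $[\frac35,\frac53]$ for some $\rho$, and $\widehat a(t)^2+\widehat a(2t)^2=1$ for $t\in[\frac12,1]$. With $F_0=1$, $F_j=L_{2^{j-1}}(\mathsf w;\cdot,\cdot)$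 for $j\ge1$, and $\psi_{z,j}(x)=\sqrt{\lambda_{z,j}}\,F_j(x,z)$, the system $\{\psi_{z,j}:z\in\Xi_j,\ j\ge0\}$ is a tight frame of $L^2(\Omega,\mathsf w)$: for every $f\in L^2(\Omega,\mathsf w)$, $$f=\sum_{j=0}^\infty\sum_{z\in\Xi_j}\langle f,\psi_{z,j}\rangle_{\mathsf w}\,\psi_{z,j}\ \text{ in }L^2(\Omega,\mathsf w),\qquad \|f\|_{2,\mathsf w}=\Big(\sum_{j=0}^\infty\sum_{z\in\Xi_j}|\langle f,\psi_{z,j}\rangle_{\mathsf w}|^2\Big)^{1/2}.$$ -/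

import Mathlib

open MeasureTheory Metric Filter Topology

namespace LocFrame

noncomputable section

/-! ### Homogeneous spaces and doubling weights

`Ω` carries the intrinsic metric `dist`; the balls `B(x, r)` are `Metric.ball x r`. The inclusion of
the domain into `ℝ^d` is a topological embedding `ι`, so that the intrinsic metric induces the usual
topology of the domain. -/

/-- The measure `w dm`. -/
def weightMeasure {Ω : Type*} [MeasurableSpace Ω] (m : Measure Ω) (w : Ω → ℝ) : Measure Ω :=
  m.withDensity fun x => ENNReal.ofReal (w x)

/-- `w(E) = ∫_E w dm`, as a real number. -/
def wmass {Ω : Type*} [MeasurableSpace Ω] (m : Measure Ω) (w : Ω → ℝ) (E : Set Ω) : ℝ :=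
  ∫ x in E, w x ∂m

/-- The reference measure `m` is a doubling measure, and for each `ε > 0` the balls of radius `ε`
have measure bounded below by a positive constant. -/
structure IsHomogeneousMeasure {Ω : Type*} [MetricSpace Ω] [MeasurableSpace Ω]
    (m : Measure Ω) : Prop where
  doubling : ∃ c : ℝ, ∀ x : Ω, ∀ r : ℝ, 0 < r → m.real (ball x (2 * r)) ≤ c * m.real (ball x r)
  ball_lower : ∀ ε : ℝ, 0 < ε → ∃ c : ℝ, 0 < c ∧ ∀ x : Ω, c ≤ m.real (ball x ε)

/-- Doubling weights: nonnegative integrable functions with `w(B(x,2r)) ≤ L w(B(x,r))`. -/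
structure IsDoublingWeight {Ω : Type*} [MetricSpace Ω] [MeasurableSpace Ω]
    (m : Measure Ω) (w : Ω → ℝ) : Prop where
  nonneg : ∀ x, 0 ≤ w x
  integrable : Integrable w m
  doubling : ∃ L : ℝ, 0 < L ∧ ∀ x : Ω, ∀ r : ℝ, 0 < r →
    wmass m w (ball x (2 * r)) ≤ L * wmass m w (ball x r)

/-! ### Polynomials, orthogonal polynomials and reproducing kernels -/

/-- `Π_n(Ω)`: restrictions to `Ω` of the polynomials in `d` variables of total degree at most `n`. -/
def polySpace {Ω : Type*} {d : ℕ} (ι : Ω → EuclideanSpace ℝ (Fin d)) (n : ℕ) :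
    Submodule ℝ (Ω → ℝ) :=
  (MvPolynomial.restrictTotalDegree (Fin d) ℝ n).map
    (LinearMap.pi fun x => (MvPolynomial.aeval (fun i => ι x i)).toLinearMap)

theorem mem_polySpace {Ω : Type*} {d : ℕ} {ι : Ω → EuclideanSpace ℝ (Fin d)} {n : ℕ} {f : Ω → ℝ} :
    f ∈ polySpace ι n ↔ ∃ p : MvPolynomial (Fin d) ℝ, p.totalDegree ≤ n ∧
      ∀ x, f x = MvPolynomial.eval (fun i => ι x i) p := by
  simp only [polySpace, Submodule.mem_map, MvPolynomial.mem_restrictTotalDegree]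
  constructor
  · rintro ⟨p, hp, rfl⟩
    exact ⟨p, hp, fun x => by simp [MvPolynomial.aeval_eq_eval]⟩
  · rintro ⟨p, hp, h⟩
    exact ⟨p, hp, by ext x; simp [MvPolynomial.aeval_eq_eval, h]⟩

/-- `V_n(Ω, μ)`: the polynomials of degree at most `n` that are orthogonal in `L²(μ)` to all
polynomials of smaller degree. -/
def orthoPoly {Ω : Type*} [MeasurableSpace Ω] {d : ℕ} (ι : Ω → EuclideanSpace ℝ (Fin d))
    (μ : Measure Ω) (n : ℕ) : Set (Ω → ℝ) :=
  {f | f ∈ polySpace ι n ∧ ∀ k < n, ∀ g ∈ polySpace ι k, ∫ x, f x * g x ∂μ = 0}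

/-- `P` is a reproducing kernel of `V_n(Ω, μ)`. -/
def IsReproducingKernel {Ω : Type*} [MeasurableSpace Ω] {d : ℕ}
    (ι : Ω → EuclideanSpace ℝ (Fin d)) (μ : Measure Ω) (n : ℕ) (P : Ω → Ω → ℝ) : Prop :=
  (∀ x, P x ∈ orthoPoly ι μ n) ∧ ∀ f ∈ orthoPoly ι μ n, ∀ x, ∫ y, f y * P x y ∂μ = f x

theorem continuous_of_mem_polySpace {Ω : Type*} [TopologicalSpace Ω] {d : ℕ}
    {ι : Ω → EuclideanSpace ℝ (Fin d)} (hι : Continuous ι) {n : ℕ} {f : Ω → ℝ}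
    (hf : f ∈ polySpace ι n) : Continuous f := by
  obtain ⟨p, -, h⟩ := mem_polySpace.1 hf
  rw [funext h]
  exact (MvPolynomial.continuous_eval p).comp (by fun_prop)

/-- The reproducing kernel of `V_n(Ω, μ)` exists and is unique. -/
theorem existsUnique_reproducingKernel {Ω : Type*} [TopologicalSpace Ω] [CompactSpace Ω]
    [MeasurableSpace Ω] [BorelSpace Ω] {d : ℕ} {ι : Ω → EuclideanSpace ℝ (Fin d)}
    (hι : Continuous ι) (μ : Measure Ω) [IsFiniteMeasure μ] [μ.IsOpenPosMeasure] (n : ℕ) :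
    ∃! P : Ω → Ω → ℝ, IsReproducingKernel ι μ n P := by
  have hint : ∀ {f g : Ω → ℝ}, Continuous f → Continuous g →
      Integrable (fun x => f x * g x) μ := fun hf hg =>
    (hf.mul hg).integrable_of_hasCompactSupport (HasCompactSupport.of_compactSpace _)
  have hc : ∀ {k : ℕ} {f : Ω → ℝ}, f ∈ polySpace ι k → Continuous f :=
    fun hf => continuous_of_mem_polySpace hι hf
  let V : Submodule ℝ (Ω → ℝ) :=
    { carrier := orthoPoly ι μ n
      add_mem' := by
        rintro f f' ⟨hf, hf'⟩ ⟨hg, hg'⟩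
        refine ⟨add_mem hf hg, fun k hk g h => ?_⟩
        simp only [Pi.add_apply, add_mul]
        rw [integral_add (hint (hc hf) (hc h)) (hint (hc hg) (hc h)), hf' k hk g h, hg' k hk g h,
          add_zero]
      zero_mem' := ⟨zero_mem _, by simp⟩
      smul_mem' := by
        rintro c f ⟨hf, hf'⟩
        refine ⟨Submodule.smul_mem _ _ hf, fun k hk g h => ?_⟩
        simp only [Pi.smul_apply, smul_eq_mul, mul_assoc]
        rw [integral_const_mul, hf' k hk g h, mul_zero] }
  have hV : ∀ {f : Ω → ℝ}, f ∈ V → Continuous f := fun hf => hc hf.1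
  have hle : V ≤ polySpace ι n := fun f hf => hf.1
  have : FiniteDimensional ℝ (polySpace ι n) := by unfold polySpace; infer_instance
  have : FiniteDimensional ℝ V := Submodule.finiteDimensional_of_le hle
  have hzero : ∀ f ∈ V, ∫ x, f x * f x ∂μ = 0 → f = 0 := by
    intro f hf h
    have h1 := (integral_eq_zero_iff_of_nonneg (fun x => mul_self_nonneg (f x))
      (hint (hV hf) (hV hf))).1 h
    have h2 := Continuous.ae_eq_iff_eq (μ := μ) ((hV hf).mul (hV hf)) continuous_zero |>.1 h1
    ext x
    exact mul_self_eq_zero.1 (congrFun h2 x)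
  let B : V →ₗ[ℝ] V →ₗ[ℝ] ℝ := LinearMap.mk₂ ℝ (fun f g => ∫ x, f.1 x * g.1 x ∂μ)
    (fun f f' g => by
      simp only [Submodule.coe_add, Pi.add_apply, add_mul]
      exact integral_add (hint (hV f.2) (hV g.2)) (hint (hV f'.2) (hV g.2)))
    (fun c f g => by
      simp only [Submodule.coe_smul, Pi.smul_apply, smul_eq_mul, mul_assoc]
      exact integral_const_mul _ _)
    (fun f g g' => by
      simp only [Submodule.coe_add, Pi.add_apply, mul_add]
      exact integral_add (hint (hV f.2) (hV g.2)) (hint (hV f.2) (hV g'.2)))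
    (fun c f g => by
      simp only [Submodule.coe_smul, Pi.smul_apply, smul_eq_mul, mul_left_comm _ c]
      exact integral_const_mul _ _)
  have hBinj : Function.Injective B := by
    rw [← LinearMap.ker_eq_bot, LinearMap.ker_eq_bot']
    intro f hf
    have : B f f = 0 := by rw [hf]; rfl
    exact Subtype.ext (hzero f.1 f.2 this)
  have hBsurj : Function.Surjective B :=
    (LinearMap.injective_iff_surjective_of_finrank_eq_finrank
      (Subspace.dual_finrank_eq (K := ℝ) (V := V)).symm).1 hBinj
  choose P hP using fun x : Ω => hBsurj ((LinearMap.proj x).comp V.subtype)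
  refine ⟨fun x => (P x).1, ⟨fun x => (P x).2, fun f hf x => ?_⟩, ?_⟩
  · have := LinearMap.congr_fun (hP x) ⟨f, hf⟩
    simp only [mul_comm (f _)]
    exact this
  · rintro Q ⟨hQ, hQ'⟩
    funext x
    have hQx : B ⟨Q x, hQ x⟩ = B (P x) := by
      rw [hP x]
      ext f
      have := hQ' f.1 f.2 x
      simp only [mul_comm (f.1 _)] at this
      exact this
    exact congrArg Subtype.val (hBinj hQx)

open Classical in
/-- `P_n(μ; x, y)`: the reproducing kernel of `V_n(Ω, μ)`. -/
def reproKernel {Ω : Type*} [MeasurableSpace Ω] {d : ℕ}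
    (ι : Ω → EuclideanSpace ℝ (Fin d)) (μ : Measure Ω) (n : ℕ) : Ω → Ω → ℝ :=
  if h : ∃ P : Ω → Ω → ℝ, IsReproducingKernel ι μ n P then h.choose else 0

/-! ### Cut-off functions and localized kernels -/

/-- Admissible cut-off functions, of type (a) or of type (b). Cut-off functions are only evaluated on
`[0, ∞)`, and the support condition of type (a) is a condition there. -/
def IsAdmissible (a : ℝ → ℝ) : Prop :=
  ContDiff ℝ (⊤ : ℕ∞) a ∧ (∀ t, 0 ≤ a t) ∧
    (((∀ t, 2 < t → a t = 0) ∧ ∀ t ∈ Set.Icc (0 : ℝ) 1, a t = 1) ∨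
      tsupport a ⊆ Set.Icc (1 / 2) 2)

/-- The kernel `L_n(μ; x, y) = ∑_k a(k/n) P_k(μ; x, y)`, for `n ≥ 1`; only `k ≤ 2n` contribute. -/
def locKernel {Ω : Type*} [MeasurableSpace Ω] {d : ℕ}
    (ι : Ω → EuclideanSpace ℝ (Fin d)) (μ : Measure Ω) (a : ℝ → ℝ) (n : ℕ) (x y : Ω) : ℝ :=
  ∑' k : ℕ, a ((k : ℝ) / (n : ℝ)) * reproKernel ι μ k x y

/-- Fast decay of the kernels `L_n(ϖ)` for the cut-off function `a`. -/
def Assertion1 {Ω : Type*} [MetricSpace Ω] [MeasurableSpace Ω] {d : ℕ}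
    (ι : Ω → EuclideanSpace ℝ (Fin d)) (m : Measure Ω) (ϖ : Ω → ℝ) (a : ℝ → ℝ) : Prop :=
  ∀ κ : ℝ, 0 < κ → ∃ c : ℝ, ∀ n : ℕ, 1 ≤ n → ∀ x y : Ω,
    |locKernel ι (weightMeasure m ϖ) a n x y| ≤
      c / (√(wmass m ϖ (ball x (1 / n))) * √(wmass m ϖ (ball y (1 / n))) *
        (1 + n * dist x y) ^ κ)

/-- Fast decay of differences of the kernels `L_n(ϖ)` for the cut-off function `a`. -/
def Assertion2 {Ω : Type*} [MetricSpace Ω] [MeasurableSpace Ω] {d : ℕ}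
    (ι : Ω → EuclideanSpace ℝ (Fin d)) (m : Measure Ω) (ϖ : Ω → ℝ) (a : ℝ → ℝ) : Prop :=
  ∃ δ₀ : ℝ, 0 < δ₀ ∧ δ₀ < 1 ∧ ∀ κ : ℝ, 0 < κ → ∃ c : ℝ, ∀ n : ℕ, 1 ≤ n →
    ∀ δ : ℝ, 0 < δ → δ ≤ δ₀ → ∀ x₁ x₂ y : Ω, x₁ ∈ ball x₂ (δ / n) →
      |locKernel ι (weightMeasure m ϖ) a n x₁ y - locKernel ι (weightMeasure m ϖ) a n x₂ y| ≤
        c * (n * dist x₁ x₂) /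
          (√(wmass m ϖ (ball x₁ (1 / n))) * √(wmass m ϖ (ball x₂ (1 / n))) *
            (1 + n * dist x₂ y) ^ κ)

/-- For all sufficiently large `κ`, the integrals of
`ϖ(y) / (ϖ(B(y, 1/n)) (1 + n d(x,y))^κ)` are bounded uniformly in `n` and `x`. -/
def Assertion3 {Ω : Type*} [MetricSpace Ω] [MeasurableSpace Ω]
    (m : Measure Ω) (ϖ : Ω → ℝ) : Prop :=
  ∃ κ₀ : ℝ, 0 < κ₀ ∧ ∀ κ : ℝ, κ₀ ≤ κ → ∃ c : ℝ, ∀ n : ℕ, 1 ≤ n → ∀ x : Ω,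
    ∫⁻ y, ENNReal.ofReal
      (ϖ y / (wmass m ϖ (ball y (1 / n)) * (1 + n * dist x y) ^ κ)) ∂m ≤ ENNReal.ofReal c

/-- `(Ω, ϖ, dist)` is a localizable homogeneous space: `ϖ` is a normalized doubling weight whose
kernels `L_n(ϖ)` are highly localized for every admissible cut-off function. -/
structure IsLocalizable {Ω : Type*} [MetricSpace Ω] [MeasurableSpace Ω] {d : ℕ}
    (ι : Ω → EuclideanSpace ℝ (Fin d)) (m : Measure Ω) (ϖ : Ω → ℝ) : Prop where
  doublingWeight : IsDoublingWeight m ϖ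
  normalized : ∫ x, ϖ x ∂m = 1
  assertion1 : ∀ a : ℝ → ℝ, IsAdmissible a → Assertion1 ι m ϖ a
  assertion2 : ∀ a : ℝ → ℝ, IsAdmissible a → Assertion2 ι m ϖ a
  assertion3 : Assertion3 m ϖ

/-- Existence of fast decaying polynomials on `Ω`. For each decay exponent `γ > 1` there are
polynomials `T_x` of degree at most `n`, and a polynomial `q` bounded above and below such that
`q(x) T_x(y)` is a polynomial of degree at most `r n` in `x`; the constants do not depend on `n`, `x`
and `y`. (The polynomials may depend on `γ`; families that serve all `γ` at once are a special case.) -/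
def Assertion4 {Ω : Type*} [MetricSpace Ω] {d : ℕ} (ι : Ω → EuclideanSpace ℝ (Fin d)) : Prop :=
  ∀ γ : ℝ, 1 < γ → ∃ δ cγ c₁ c₂ : ℝ, ∃ r : ℕ, 0 < δ ∧ 0 < c₁ ∧ 0 < c₂ ∧ 0 < r ∧
    ∀ n : ℕ, 1 ≤ n → ∃ (T : Ω → Ω → ℝ) (q : Ω → ℝ),
      (∀ x, T x ∈ polySpace ι n ∧ T x x = 1 ∧ (∀ y ∈ ball x (1 / n), δ ≤ T x y) ∧
        ∀ y, 0 ≤ T x y ∧ T x y ≤ cγ * (1 + n * dist x y) ^ (-γ)) ∧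
      (∃ N, q ∈ polySpace ι N) ∧ (∀ x, c₁ ≤ q x ∧ q x ≤ c₂) ∧
      ∀ y, (fun x => q x * T x y) ∈ polySpace ι (r * n)

/-! ### Separated sets, cubature rules and needlets -/

/-- `Ξ` is a maximal `ε`-separated subset of `Ω`. -/
def IsMaximalSeparated {Ω : Type*} [MetricSpace Ω] (ε : ℝ) (Ξ : Finset Ω) : Prop :=
  (∀ x ∈ Ξ, ∀ y ∈ Ξ, x ≠ y → ε ≤ dist x y) ∧
    ∃ c : ℝ, 1 < c ∧ ∀ x : Ω, 1 ≤ ∑ z ∈ Ξ, (ball z ε).indicator (fun _ => (1 : ℝ)) x ∧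
      ∑ z ∈ Ξ, (ball z ε).indicator (fun _ => (1 : ℝ)) x ≤ c

/-- A positive cubature rule of degree `n` for the weight `w`, with nodes `Ξ` and weights `lam`. -/
def IsPositiveCubature {Ω : Type*} [MeasurableSpace Ω] {d : ℕ}
    (ι : Ω → EuclideanSpace ℝ (Fin d)) (m : Measure Ω) (w : Ω → ℝ) (n : ℕ)
    (Ξ : Finset Ω) (lam : Ω → ℝ) : Prop :=
  (∀ z ∈ Ξ, 0 < lam z) ∧
    ∀ f ∈ polySpace ι n, ∫ x, f x * w x ∂m = ∑ z ∈ Ξ, lam z * f z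

/-- Cut-off functions used for frames: smooth, nonnegative, supported in `[1/2, 2]`, bounded away
from zero on `[3/5, 5/3]`, and with `a(t)² + a(2t)² = 1` on `[1/2, 1]`. -/
def IsFrameCutoff (a : ℝ → ℝ) : Prop :=
  ContDiff ℝ (⊤ : ℕ∞) a ∧ (∀ t, 0 ≤ a t) ∧ tsupport a ⊆ Set.Icc (1 / 2) 2 ∧
    (∃ ρ : ℝ, 0 < ρ ∧ ∀ t ∈ Set.Icc (3 / 5 : ℝ) (5 / 3), ρ ≤ a t) ∧
    ∀ t ∈ Set.Icc (1 / 2 : ℝ) 1, a t ^ 2 + a (2 * t) ^ 2 = 1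

/-- `F_0 = 1` and `F_j = L_{2^{j-1}}(w)` for `j ≥ 1`. -/
def frameKernel {Ω : Type*} [MeasurableSpace Ω] {d : ℕ}
    (ι : Ω → EuclideanSpace ℝ (Fin d)) (μ : Measure Ω) (a : ℝ → ℝ) : ℕ → Ω → Ω → ℝ
  | 0 => fun _ _ => 1
  | j + 1 => locKernel ι μ a (2 ^ j)

/-- The needlet `ψ_{z,j}(x) = √λ_{z,j} F_j(x, z)`. -/
def needlet {Ω : Type*} [MeasurableSpace Ω] {d : ℕ}
    (ι : Ω → EuclideanSpace ℝ (Fin d)) (μ : Measure Ω) (a : ℝ → ℝ) (lam : ℕ → Ω → ℝ)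
    (j : ℕ) (z x : Ω) : ℝ :=
  √(lam j z) * frameKernel ι μ a j x z

/-- The system `ψ j z`, `z ∈ Ξ j`, is a tight frame (with frame bound one) of the real space `L²(μ)`:
every `f` has the frame expansion in `L²(μ)`, and Parseval's identity holds. -/
def IsTightFrame {Ω : Type*} [MeasurableSpace Ω] (μ : Measure Ω) (Ξ : ℕ → Finset Ω)
    (ψ : ℕ → Ω → Ω → ℝ) : Prop :=
  (∀ j, ∀ z ∈ Ξ j, MemLp (ψ j z) 2 μ) ∧
    ∀ f : Ω → ℝ, MemLp f 2 μ →
      Tendsto (fun R : ℕ => eLpNorm (fun x => f x -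
        ∑ j ∈ Finset.range R, ∑ z ∈ Ξ j, (∫ y, f y * ψ j z y ∂μ) * ψ j z x) 2 μ)
        atTop (𝓝 0) ∧
      HasSum (fun j => ∑ z ∈ Ξ j, |∫ y, f y * ψ j z y ∂μ| ^ 2) ((eLpNorm f 2 μ).toReal ^ 2)

end

end LocFrame

/-! Existence of the cubature. Only the kernels of `ϖ` are known to be localized, but a pointwise
estimate for polynomials can be integrated against any doubling measure. A polynomial `f` of degree
`n` is reproduced by `L_n(ϖ)`, and the decay of kernel differences bounds its oscillation at scale
`ε`, for small `nε`, by `nε` times a Peetre maximal function of `f`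
(`IsLocalizable.exists_osc_le_peetre`). For `μ = w dm`, averaging over small balls and absorbing
half of the maximal function bounds the latter by an average of `|f|` whose `L¹(μ)` norm is at most
a constant times that of `f` (`IsLocalizable.exists_osc_le`). Hence, for dense nodes, replacing `f`
by the function interpolating its node values along a partition of unity costs at most a quarter of
`∫ |f| dμ`. So `∫ f dμ` dominates a positive combination of the values of `f` at the nodes whenever
these are nonnegative, and convex duality turns this into positive weights with the lower bound
(`exists_weights_of_dominates`, `IsLocalizable.exists_cubature`). The upper bound comes from
integrating the polynomial `T_z`, which is nonnegative, equals `1` at `z` and is concentrated there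
(`exists_weight_le`).

Tight frame. `F_j` acts on the component of degree `k` as a multiplier, and the squares of these
multipliers sum to `1` over `j` for each `k`. Products of two polynomials of degree `2 ^ j` are
integrated exactly by the cubature, so the sums over nodes equal the continuous expressions
(`IsFrameCutoff.sum_sq_integral_mul_needlet`, `IsFrameCutoff.sum_integral_mul_needlet_mul`). What
remains is Parseval's identity for orthogonal polynomials, which follows from Stone–Weierstrass
(`tendsto_sum_projNormSq`). -/

namespace LocFrame

/-! ### The measure defined by a weight -/

section WeightMeasure

variable {Ω : Type*} [MeasurableSpace Ω] {m : Measure Ω} {w : Ω → ℝ}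

theorem isFiniteMeasure_weightMeasure (hw : Integrable w m) :
    IsFiniteMeasure (weightMeasure m w) :=
  isFiniteMeasure_withDensity_ofReal hw.2

theorem integral_weightMeasure (hw : Integrable w m) (hw0 : ∀ x, 0 ≤ w x) (f : Ω → ℝ) :
    ∫ x, f x ∂(weightMeasure m w) = ∫ x, f x * w x ∂m := by
  unfold weightMeasure
  rw [integral_withDensity_eq_integral_toReal_smul₀ hw.aemeasurable.ennreal_ofReal
    (by simp)]
  simp [ENNReal.toReal_ofReal (hw0 _), mul_comm]

theorem weightMeasure_real (hw : Integrable w m) (hw0 : ∀ x, 0 ≤ w x) {E : Set Ω}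
    (hE : MeasurableSet E) : (weightMeasure m w).real E = wmass m w E := by
  rw [wmass, integral_eq_lintegral_of_nonneg_ae (Eventually.of_forall hw0) hw.1.restrict,
    measureReal_def, weightMeasure, withDensity_apply _ hE]

end WeightMeasure

/-! ### Doubling measures -/

section Decay

variable {Ω : Type*} [MetricSpace Ω]

theorem continuous_decay {s : ℝ} (hs : 0 ≤ s) (K : ℕ) :
    Continuous fun p : Ω × Ω => ((1 + s * dist p.1 p.2) ^ K)⁻¹ :=
  Continuous.inv₀ (by fun_prop) fun p => by positivity

theorem continuous_decay_right {s : ℝ} (hs : 0 ≤ s) (K : ℕ) (x : Ω) :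
    Continuous fun y => ((1 + s * dist x y) ^ K)⁻¹ :=
  (continuous_decay hs K).comp (by fun_prop : Continuous fun y => (x, y))

end Decay

/-- `μ(B(x,2r)) ≤ L μ(B(x,r))` for all balls. -/
def DoublingMeasure {Ω : Type*} [MetricSpace Ω] [MeasurableSpace Ω] (μ : Measure Ω) (L : ℝ) :
    Prop :=
  0 < L ∧ ∀ x : Ω, ∀ r : ℝ, 0 < r → μ.real (ball x (2 * r)) ≤ L * μ.real (ball x r)

section Doubling

variable {Ω : Type*} [MetricSpace Ω] [MeasurableSpace Ω] {μ : Measure Ω} {L : ℝ}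

theorem IsDoublingWeight.doublingMeasure [OpensMeasurableSpace Ω] {m : Measure Ω} {w : Ω → ℝ}
    (hw : IsDoublingWeight m w) : ∃ L, DoublingMeasure (weightMeasure m w) L := by
  obtain ⟨L, hL, h⟩ := hw.doubling
  refine ⟨L, hL, fun x r hr => ?_⟩
  rw [weightMeasure_real hw.integrable hw.nonneg measurableSet_ball,
    weightMeasure_real hw.integrable hw.nonneg measurableSet_ball]
  exact h x r hr

theorem DoublingMeasure.ball_pow (h : DoublingMeasure μ L) (x : Ω) {r : ℝ} (hr : 0 < r) (k : ℕ) :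
    μ.real (ball x (2 ^ k * r)) ≤ L ^ k * μ.real (ball x r) := by
  induction k with
  | zero => simp
  | succ k ih =>
    calc μ.real (ball x (2 ^ (k + 1) * r)) = μ.real (ball x (2 * (2 ^ k * r))) := by ring_nf
      _ ≤ L * μ.real (ball x (2 ^ k * r)) := h.2 x _ (by positivity)
      _ ≤ L * (L ^ k * μ.real (ball x r)) := mul_le_mul_of_nonneg_left ih h.1.le
      _ = _ := by ring

/-- The mass of a ball is controlled by the mass of a concentric ball smaller by a given factor. -/
theorem DoublingMeasure.exists_ball_le [IsFiniteMeasure μ] (h : DoublingMeasure μ L) {t : ℝ}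
    (ht : 0 < t) :
    ∃ C, 0 < C ∧ ∀ (x : Ω) (r : ℝ), 0 < r → μ.real (ball x r) ≤ C * μ.real (ball x (t * r)) := by
  obtain ⟨k, hk⟩ := pow_unbounded_of_one_lt t⁻¹ (one_lt_two : (1 : ℝ) < 2)
  refine ⟨L ^ k, pow_pos h.1 k, fun x r hr => ?_⟩
  refine le_trans (measureReal_mono (ball_subset_ball ?_)) (h.ball_pow x (mul_pos ht hr) k)
  have : 1 ≤ 2 ^ k * t := by
    rw [inv_lt_iff_one_lt_mul₀ ht] at hk
    exact hk.le
  nlinarith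

theorem DoublingMeasure.ball_le_of_dist_le [IsFiniteMeasure μ] (h : DoublingMeasure μ L) {x y : Ω}
    {r : ℝ} (hr : 0 < r) (hxy : dist x y ≤ r) : μ.real (ball x r) ≤ L * μ.real (ball y r) :=
  le_trans (measureReal_mono (ball_subset_ball' (by linarith))) (h.2 y r hr)

/-- A null open set contains a null ball; finitely many doublings of that ball cover the bounded
space, so the whole measure would vanish. -/
theorem DoublingMeasure.isOpenPosMeasure [CompactSpace Ω] [IsFiniteMeasure μ]
    (h : DoublingMeasure μ L) (hμ : μ ≠ 0) : μ.IsOpenPosMeasure := by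
  refine ⟨fun U hU ⟨x, hx⟩ h0 => hμ ?_⟩
  obtain ⟨r, hr, hrU⟩ := Metric.isOpen_iff.1 hU x hx
  obtain ⟨R, hR⟩ := (isCompact_univ : IsCompact (Set.univ : Set Ω)).isBounded.subset_ball x
  obtain ⟨k, hk⟩ := pow_unbounded_of_one_lt (R / r) (one_lt_two : (1 : ℝ) < 2)
  have h1 : μ.real (ball x r) = 0 := by
    rw [measureReal_def, measure_mono_null hrU h0, ENNReal.toReal_zero]
  have h2 := h.ball_pow x hr k
  rw [h1, mul_zero] at h2
  have h3 : μ.real Set.univ ≤ 0 :=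
    (measureReal_mono (hR.trans (ball_subset_ball ((div_lt_iff₀ hr).1 hk).le))).trans h2
  rw [← Measure.measure_univ_eq_zero]
  exact (measureReal_eq_zero_iff).1 (le_antisymm h3 measureReal_nonneg)

theorem measureReal_ball_pos [μ.IsOpenPosMeasure] [IsFiniteMeasure μ] (x : Ω) {r : ℝ}
    (hr : 0 < r) : 0 < μ.real (ball x r) :=
  ENNReal.toReal_pos (measure_ball_pos μ x hr).ne' (measure_ne_top μ _)

theorem integrable_of_continuous {X : Type*} [TopologicalSpace X] [CompactSpace X]
    [MeasurableSpace X] [OpensMeasurableSpace X] {μ : Measure X} [IsFiniteMeasure μ] {f : X → ℝ}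
    (hf : Continuous f) : Integrable f μ :=
  hf.integrable_of_hasCompactSupport (HasCompactSupport.of_compactSpace _)

/-- Polynomially decaying functions of sufficiently high order are integrable against a doubling
measure with the mass of the ball as a bound. -/
theorem DoublingMeasure.exists_integral_decay_le [CompactSpace Ω] [OpensMeasurableSpace Ω]
    [IsFiniteMeasure μ] (h : DoublingMeasure μ L) :
    ∃ K : ℕ, ∃ C : ℝ, 0 < C ∧ ∀ s : ℝ, 0 < s → ∀ x : Ω,
      ∫ y, ((1 + s * dist x y) ^ K)⁻¹ ∂μ ≤ C * μ.real (ball x (1 / s)) := by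
  -- With `2 * L < 2 ^ K` the decay gained on each dyadic shell beats the growth `L` of the mass,
  -- leaving a geometric series of ratio `1 / 2`.
  obtain ⟨K, hK⟩ := pow_unbounded_of_one_lt (2 * L) (one_lt_two : (1 : ℝ) < 2)
  refine ⟨K, 2 ^ K * 2, by positivity, fun s hs x => ?_⟩
  obtain ⟨R, hR⟩ := (isCompact_univ : IsCompact (Set.univ : Set Ω)).isBounded.subset_ball x
  -- The number of shells depends on `s` and `x`, but the final constant does not.
  obtain ⟨M, hM⟩ := pow_unbounded_of_one_lt (s * R) (one_lt_two : (1 : ℝ) < 2)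
  have hpt : ∀ y, ((1 + s * dist x y) ^ K)⁻¹ ≤
      ∑ k ∈ Finset.range (M + 1), (ball x (2 ^ k * (1 / s))).indicator
        (fun _ => 2 ^ K * ((2 : ℝ) ^ K)⁻¹ ^ k) y := by
    intro y
    have hyM : s * dist x y < 2 ^ M := by
      have := hR (Set.mem_univ y)
      rw [mem_ball, dist_comm] at this
      exact lt_of_le_of_lt (mul_le_mul_of_nonneg_left this.le hs.le) hM
    have hex : ∃ k : ℕ, s * dist x y < 2 ^ k := ⟨M, hyM⟩
    classical
    -- The shell of `y`: minimality of `k` gives `2 ^ k ≤ 2 * (1 + s * dist x y)`, including the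
    -- innermost case `k = 0`.
    set k := Nat.find hex with hk
    have hk1 : s * dist x y < 2 ^ k := Nat.find_spec hex
    have hkM : k ≤ M := Nat.find_min' hex hyM
    have hlow : (2 : ℝ) ^ k ≤ 2 * (1 + s * dist x y) := by
      have hd : 0 ≤ s * dist x y := by positivity
      rcases Nat.eq_zero_or_pos k with h0 | h0
      · rw [h0]; norm_num; linarith
      · have := Nat.find_min hex (m := k - 1) (by omega)
        rw [not_lt] at this
        have h2 : (2 : ℝ) ^ k = 2 * 2 ^ (k - 1) := by
          rw [← pow_succ', Nat.sub_add_cancel h0]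
        linarith
    have hmem : y ∈ ball x (2 ^ k * (1 / s)) := by
      rw [mem_ball, dist_comm, mul_one_div, lt_div_iff₀ hs]; linarith
    refine le_trans ?_ (Finset.single_le_sum (f := fun k => (ball x (2 ^ k * (1 / s))).indicator
        (fun _ => 2 ^ K * ((2 : ℝ) ^ K)⁻¹ ^ k) y)
        (fun i _ => Set.indicator_nonneg (fun _ _ => by positivity) _)
        (Finset.mem_range.2 (Nat.lt_succ_of_le hkM)))
    simp only [Set.indicator_of_mem hmem]
    rw [inv_pow, ← div_eq_mul_inv, inv_le_comm₀ (by positivity) (by positivity), inv_div,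
      div_le_iff₀ (by positivity), ← mul_pow, ← pow_mul, mul_comm K k, pow_mul]
    exact pow_le_pow_left₀ (by positivity) (by linarith) K
  have hind : ∀ k, Integrable ((ball x (2 ^ k * (1 / s))).indicator
        (fun _ => 2 ^ K * ((2 : ℝ) ^ K)⁻¹ ^ k)) μ := fun k =>
    (integrable_const _).indicator measurableSet_ball
  calc ∫ y, ((1 + s * dist x y) ^ K)⁻¹ ∂μ
      ≤ ∫ y, ∑ k ∈ Finset.range (M + 1), (ball x (2 ^ k * (1 / s))).indicator
        (fun _ => 2 ^ K * ((2 : ℝ) ^ K)⁻¹ ^ k) y ∂μ :=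
        integral_mono (integrable_of_continuous (continuous_decay_right hs.le K x))
          (integrable_finsetSum _ fun k _ => hind k) hpt
    _ = ∑ k ∈ Finset.range (M + 1),
          μ.real (ball x (2 ^ k * (1 / s))) * (2 ^ K * ((2 : ℝ) ^ K)⁻¹ ^ k) := by
        rw [integral_finsetSum _ fun k _ => hind k]
        refine Finset.sum_congr rfl fun k _ => ?_
        rw [integral_indicator measurableSet_ball, setIntegral_const, smul_eq_mul]
    _ ≤ ∑ k ∈ Finset.range (M + 1), 2 ^ K * μ.real (ball x (1 / s)) * (1 / 2) ^ k := by
        refine Finset.sum_le_sum fun k _ => ?_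
        have h1 := h.ball_pow x (r := 1 / s) (by positivity) k
        have h2 : L ^ k * ((2 : ℝ) ^ K)⁻¹ ^ k ≤ (1 / 2) ^ k := by
          rw [← mul_pow]
          refine pow_le_pow_left₀ (mul_nonneg h.1.le (by positivity)) ?_ k
          rw [← div_eq_mul_inv, div_le_iff₀ (by positivity)]
          linarith
        calc _ ≤ L ^ k * μ.real (ball x (1 / s)) * (2 ^ K * ((2 : ℝ) ^ K)⁻¹ ^ k) :=
              mul_le_mul_of_nonneg_right h1 (by positivity)
          _ = 2 ^ K * μ.real (ball x (1 / s)) * (L ^ k * ((2 : ℝ) ^ K)⁻¹ ^ k) := by ring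
          _ ≤ _ := mul_le_mul_of_nonneg_left h2 (by positivity)
    _ ≤ 2 ^ K * 2 * μ.real (ball x (1 / s)) := by
        rw [← Finset.mul_sum]
        have : ∑ k ∈ Finset.range (M + 1), (1 / 2 : ℝ) ^ k ≤ 2 := by
          simpa using sum_geometric_two_le (M + 1)
        calc _ ≤ 2 ^ K * μ.real (ball x (1 / s)) * 2 :=
              mul_le_mul_of_nonneg_left this (by positivity)
          _ = _ := by ring

end Doubling

/-! ### Spaces of polynomials -/

section PolySpace

variable {Ω : Type*} {d : ℕ} {ι : Ω → EuclideanSpace ℝ (Fin d)}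

theorem polySpace_mono {k n : ℕ} (h : k ≤ n) : polySpace ι k ≤ polySpace ι n := by
  intro f hf
  obtain ⟨p, hp, hf⟩ := mem_polySpace.1 hf
  exact mem_polySpace.2 ⟨p, hp.trans h, hf⟩

theorem const_mem_polySpace (c : ℝ) (n : ℕ) : (fun _ : Ω => c) ∈ polySpace ι n :=
  mem_polySpace.2 ⟨MvPolynomial.C c, by simp, fun x => by simp⟩

theorem mul_mem_polySpace {k n : ℕ} {f g : Ω → ℝ} (hf : f ∈ polySpace ι k)
    (hg : g ∈ polySpace ι n) : (fun x => f x * g x) ∈ polySpace ι (k + n) := by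
  obtain ⟨p, hp, hf⟩ := mem_polySpace.1 hf
  obtain ⟨q, hq, hg⟩ := mem_polySpace.1 hg
  exact mem_polySpace.2 ⟨p * q, (MvPolynomial.totalDegree_mul p q).trans (add_le_add hp hq),
    fun x => by simp [hf, hg]⟩

instance finiteDimensional_polySpace (n : ℕ) : FiniteDimensional ℝ (polySpace ι n) := by
  unfold polySpace; infer_instance

end PolySpace

/-! ### Orthogonal decomposition of polynomials and the multiplier action of the kernels. -/

section Kernels

variable {Ω : Type*} [TopologicalSpace Ω] [CompactSpace Ω] [MeasurableSpace Ω] [BorelSpace Ω]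
  {d : ℕ} {ι : Ω → EuclideanSpace ℝ (Fin d)} {μ : Measure Ω} [IsFiniteMeasure μ]

omit [IsFiniteMeasure μ] in
theorem integrable_mul_continuous {f g : Ω → ℝ} (hf : Integrable f μ) (hg : Continuous g) :
    Integrable (fun x => f x * g x) μ := by
  obtain ⟨C, hC⟩ := isCompact_univ.exists_bound_of_continuousOn hg.continuousOn
  exact hf.mul_bdd (c := C) hg.aestronglyMeasurable (Eventually.of_forall fun x => hC x trivial)

theorem integrable_continuous_mul {f g : Ω → ℝ} (hf : Continuous f) (hg : Continuous g) :
    Integrable (fun x => f x * g x) μ :=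
  integrable_of_continuous (hf.mul hg)

variable [μ.IsOpenPosMeasure]

theorem eq_zero_of_integral_mul_self {f : Ω → ℝ} (hf : Continuous f)
    (h : ∫ x, f x * f x ∂μ = 0) : f = 0 := by
  have h1 := (integral_eq_zero_iff_of_nonneg (fun x => mul_self_nonneg (f x))
    (integrable_of_continuous (hf.mul hf))).1 h
  have h2 := Continuous.ae_eq_iff_eq (μ := μ) (hf.mul hf) continuous_zero |>.1 h1
  ext x
  exact mul_self_eq_zero.1 (congrFun h2 x)

/-- Linear functionals on a space of polynomials are represented by polynomials. -/
theorem exists_integral_mul_eq (hι : Continuous ι) {n : ℕ} {V : Submodule ℝ (Ω → ℝ)}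
    (hV : V ≤ polySpace ι n) (φ : V →ₗ[ℝ] ℝ) :
    ∃ p ∈ V, ∀ g : V, ∫ x, p x * g.1 x ∂μ = φ g := by
  have hc : ∀ f : V, Continuous f.1 := fun f => continuous_of_mem_polySpace hι (hV f.2)
  have hint : ∀ f g : V, Integrable (fun x => f.1 x * g.1 x) μ := fun f g =>
    integrable_of_continuous ((hc f).mul (hc g))
  have : FiniteDimensional ℝ V := Submodule.finiteDimensional_of_le hV
  let B : V →ₗ[ℝ] V →ₗ[ℝ] ℝ := LinearMap.mk₂ ℝ (fun f g => ∫ x, f.1 x * g.1 x ∂μ)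
    (fun f f' g => by
      simp only [Submodule.coe_add, Pi.add_apply, add_mul]
      exact integral_add (hint f g) (hint f' g))
    (fun c f g => by
      simp only [Submodule.coe_smul, Pi.smul_apply, smul_eq_mul, mul_assoc]
      exact integral_const_mul _ _)
    (fun f g g' => by
      simp only [Submodule.coe_add, Pi.add_apply, mul_add]
      exact integral_add (hint f g) (hint f g'))
    (fun c f g => by
      simp only [Submodule.coe_smul, Pi.smul_apply, smul_eq_mul, mul_left_comm _ c]
      exact integral_const_mul _ _)
  have hBinj : Function.Injective B := by
    rw [← LinearMap.ker_eq_bot, LinearMap.ker_eq_bot']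
    intro f hf
    have : B f f = 0 := by rw [hf]; rfl
    exact Subtype.ext (eq_zero_of_integral_mul_self (hc f) this)
  obtain ⟨p, hp⟩ := (LinearMap.injective_iff_surjective_of_finrank_eq_finrank
      (Subspace.dual_finrank_eq (K := ℝ) (V := V)).symm).1 hBinj φ
  exact ⟨p.1, p.2, fun g => LinearMap.congr_fun hp g⟩

/-- The linear functional `g ↦ ∫ f g` on a space of polynomials. -/
noncomputable def integralFunctional (hι : Continuous ι) {n : ℕ} {V : Submodule ℝ (Ω → ℝ)}
    (hV : V ≤ polySpace ι n) {f : Ω → ℝ} (hf : Integrable f μ) : V →ₗ[ℝ] ℝ where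
  toFun g := ∫ x, f x * g.1 x ∂μ
  map_add' g g' := by
    simp only [Submodule.coe_add, Pi.add_apply, mul_add]
    exact integral_add
      (integrable_mul_continuous hf (continuous_of_mem_polySpace hι (hV g.2)))
      (integrable_mul_continuous hf (continuous_of_mem_polySpace hι (hV g'.2)))
  map_smul' c g := by
    simp only [Submodule.coe_smul, Pi.smul_apply, smul_eq_mul, mul_left_comm _ c,
      RingHom.id_apply]
    exact integral_const_mul _ _

/-- The space of orthogonal polynomials, as a submodule. -/
def orthoSubmodule (hι : Continuous ι) (μ : Measure Ω) [IsFiniteMeasure μ] (n : ℕ) :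
    Submodule ℝ (Ω → ℝ) where
  carrier := orthoPoly ι μ n
  add_mem' := by
    rintro f f' ⟨hf, hf'⟩ ⟨hg, hg'⟩
    refine ⟨add_mem hf hg, fun k hk g h => ?_⟩
    have hc := continuous_of_mem_polySpace hι h
    simp only [Pi.add_apply, add_mul]
    rw [integral_add (integrable_continuous_mul (continuous_of_mem_polySpace hι hf) hc)
      (integrable_continuous_mul (continuous_of_mem_polySpace hι hg) hc), hf' k hk g h,
      hg' k hk g h, add_zero]
  zero_mem' := ⟨zero_mem _, by simp⟩
  smul_mem' := by
    rintro c f ⟨hf, hf'⟩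
    refine ⟨Submodule.smul_mem _ _ hf, fun k hk g h => ?_⟩
    simp only [Pi.smul_apply, smul_eq_mul, mul_assoc]
    rw [integral_const_mul, hf' k hk g h, mul_zero]

theorem isReproducingKernel_reproKernel (hι : Continuous ι) (n : ℕ) :
    IsReproducingKernel ι μ n (reproKernel ι μ n) := by
  have h := (existsUnique_reproducingKernel hι μ n).exists
  rw [reproKernel, dif_pos h]
  exact h.choose_spec

theorem reproKernel_mem (hι : Continuous ι) (n : ℕ) (x : Ω) :
    reproKernel ι μ n x ∈ orthoPoly ι μ n :=
  (isReproducingKernel_reproKernel hι n).1 x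

theorem continuous_reproKernel (hι : Continuous ι) (n : ℕ) (x : Ω) :
    Continuous (reproKernel ι μ n x) :=
  continuous_of_mem_polySpace hι (reproKernel_mem hι n x).1

theorem reproKernel_comm (hι : Continuous ι) (n : ℕ) (x y : Ω) :
    reproKernel ι μ n x y = reproKernel ι μ n y x := by
  have h := isReproducingKernel_reproKernel (μ := μ) hι n
  rw [← h.2 _ (h.1 x) y, ← h.2 _ (h.1 y) x]
  exact integral_congr_ae (Eventually.of_forall fun z => mul_comm _ _)

/-- The component of `f` in `V_n(Ω, μ)`. -/
noncomputable def polyProj (ι : Ω → EuclideanSpace ℝ (Fin d)) (μ : Measure Ω) (n : ℕ) (f : Ω → ℝ)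
    (x : Ω) : ℝ :=
  ∫ y, f y * reproKernel ι μ n x y ∂μ

theorem polyProj_eq_self (hι : Continuous ι) {n : ℕ} {f : Ω → ℝ} (hf : f ∈ orthoPoly ι μ n) :
    polyProj ι μ n f = f :=
  funext fun x => (isReproducingKernel_reproKernel hι n).2 f hf x

/-- The functional `g ↦ ∫ f g` on `V_n` is represented by some `p ∈ V_n`. Testing it on the
reproducing kernel identifies `p` with `polyProj ι μ n f`. -/
theorem polyProj_mem_and_integral (hι : Continuous ι) (n : ℕ) {f : Ω → ℝ} (hf : Integrable f μ) :
    polyProj ι μ n f ∈ orthoPoly ι μ n ∧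
      ∀ g ∈ orthoPoly ι μ n, ∫ x, polyProj ι μ n f x * g x ∂μ = ∫ x, f x * g x ∂μ := by
  have hV : orthoSubmodule hι μ n ≤ polySpace ι n := fun f hf => hf.1
  obtain ⟨p, hp, h⟩ := exists_integral_mul_eq (μ := μ) hι hV (integralFunctional hι hV hf)
  have : polyProj ι μ n f = p := by
    rw [← polyProj_eq_self hι (show p ∈ orthoPoly ι μ n from hp)]
    funext x
    exact (h ⟨_, reproKernel_mem hι n x⟩).symm
  rw [this]
  exact ⟨hp, fun g hg => h ⟨g, hg⟩⟩

theorem polyProj_mem (hι : Continuous ι) (n : ℕ) {f : Ω → ℝ} (hf : Integrable f μ) :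
    polyProj ι μ n f ∈ orthoPoly ι μ n :=
  (polyProj_mem_and_integral hι n hf).1

theorem continuous_polyProj (hι : Continuous ι) (n : ℕ) {f : Ω → ℝ} (hf : Integrable f μ) :
    Continuous (polyProj ι μ n f) :=
  continuous_of_mem_polySpace hι (polyProj_mem hι n hf).1

theorem integral_polyProj_mul (hι : Continuous ι) {n : ℕ} {f g : Ω → ℝ} (hf : Integrable f μ)
    (hg : g ∈ orthoPoly ι μ n) : ∫ x, polyProj ι μ n f x * g x ∂μ = ∫ x, f x * g x ∂μ :=
  (polyProj_mem_and_integral hι n hf).2 g hg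

omit [IsFiniteMeasure μ] [μ.IsOpenPosMeasure] [TopologicalSpace Ω] [CompactSpace Ω]
  [BorelSpace Ω] in
theorem integral_mul_eq_zero_of_ne {k n : ℕ} (h : k ≠ n) {f g : Ω → ℝ}
    (hf : f ∈ orthoPoly ι μ k) (hg : g ∈ orthoPoly ι μ n) : ∫ x, f x * g x ∂μ = 0 := by
  rcases lt_or_gt_of_ne h with h | h
  · simp only [mul_comm (f _)]
    exact hg.2 k h f hf.1
  · exact hf.2 n h g hg.1

theorem exists_sum_orthoPoly (hι : Continuous ι) (n : ℕ) {f : Ω → ℝ} (hf : f ∈ polySpace ι n) :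
    ∃ g : ℕ → Ω → ℝ, (∀ k, g k ∈ orthoPoly ι μ k) ∧
      ∀ x, f x = ∑ k ∈ Finset.range (n + 1), g k x := by
  induction n generalizing f with
  | zero =>
    refine ⟨fun k => if k = 0 then f else 0, fun k => ?_, fun x => by simp⟩
    dsimp only
    split_ifs with h
    · subst h
      exact ⟨hf, by simp⟩
    · exact (orthoSubmodule hι μ k).zero_mem
  | succ n ih =>
    have hfc := continuous_of_mem_polySpace hι hf
    obtain ⟨p, hp, h⟩ := exists_integral_mul_eq (μ := μ) hι le_rfl
      (integralFunctional hι (le_refl (polySpace ι n)) (integrable_of_continuous (μ := μ) hfc))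
    obtain ⟨g, hg, hsum⟩ := ih hp
    have hpc := continuous_of_mem_polySpace hι hp
    -- Here `p` is the orthogonal projection of `f` onto polynomials of degree at most `n`.
    have hfp : f - p ∈ orthoPoly ι μ (n + 1) := by
      refine ⟨sub_mem hf (polySpace_mono n.le_succ hp), fun k hk q hq => ?_⟩
      have hqc := continuous_of_mem_polySpace hι hq
      simp only [Pi.sub_apply, sub_mul]
      rw [integral_sub (integrable_continuous_mul hfc hqc)
        (integrable_continuous_mul hpc hqc), sub_eq_zero]
      exact (h ⟨q, polySpace_mono (Nat.lt_succ_iff.1 hk) hq⟩).symm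
    refine ⟨fun k => if k = n + 1 then f - p else g k, fun k => ?_, fun x => ?_⟩
    · dsimp only
      split_ifs with h
      · subst h
        exact hfp
      · exact hg k
    · have hk : ∀ k ∈ Finset.range (n + 1), (if k = n + 1 then f - p else g k) x = g k x :=
        fun k hk => congrFun (if_neg (Finset.mem_range.1 hk).ne) x
      rw [Finset.sum_range_succ, Finset.sum_congr rfl hk, ← hsum x]
      simp

theorem polyProj_sum (hι : Continuous ι) {n : ℕ} {g : ℕ → Ω → ℝ}
    (hg : ∀ k, g k ∈ orthoPoly ι μ k) (k : ℕ) (x : Ω) :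
    polyProj ι μ k (fun y => ∑ i ∈ Finset.range n, g i y) x = if k < n then g k x else 0 := by
  unfold polyProj
  simp only [Finset.sum_mul]
  rw [integral_finsetSum _ fun i _ => integrable_continuous_mul
    (continuous_of_mem_polySpace hι (hg i).1) (continuous_reproKernel hι k x)]
  have h : ∀ i, ∫ y, g i y * reproKernel ι μ k x y ∂μ = if i = k then g k x else 0 := by
    intro i
    split_ifs with hik
    · subst hik
      exact (isReproducingKernel_reproKernel hι i).2 _ (hg i) x
    · exact integral_mul_eq_zero_of_ne hik (hg i) (reproKernel_mem hι k x)
  simp [h]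

theorem polyProj_eq_zero (hι : Continuous ι) {k n : ℕ} (hkn : n < k) {f : Ω → ℝ}
    (hf : f ∈ polySpace ι n) : polyProj ι μ k f = 0 := by
  funext x
  unfold polyProj
  simp only [mul_comm (f _)]
  exact (reproKernel_mem hι k x).2 n hkn f hf

theorem sum_polyProj (hι : Continuous ι) {n : ℕ} {f : Ω → ℝ} (hf : f ∈ polySpace ι n) (x : Ω) :
    ∑ k ∈ Finset.range (n + 1), polyProj ι μ k f x = f x := by
  obtain ⟨g, hg, h⟩ := exists_sum_orthoPoly (μ := μ) hι n hf
  rw [h x]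
  refine Finset.sum_congr rfl fun k hk => ?_
  rw [funext h, polyProj_sum hι hg, if_pos (Finset.mem_range.1 hk)]

omit [IsFiniteMeasure μ] [μ.IsOpenPosMeasure] [TopologicalSpace Ω] [CompactSpace Ω]
  [BorelSpace Ω] in
theorem locKernel_eq_sum {a : ℝ → ℝ} (ha : ∀ t, 2 < t → a t = 0) {n : ℕ} (hn : 1 ≤ n) (x y : Ω) :
    locKernel ι μ a n x y =
      ∑ k ∈ Finset.range (2 * n + 1), a ((k : ℝ) / (n : ℝ)) * reproKernel ι μ k x y := by
  -- The index `k = 2 * n` has to stay, since `a` is only assumed to vanish strictly beyond `2`.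
  refine tsum_eq_sum fun k hk => ?_
  rw [ha, zero_mul]
  rw [Finset.mem_range, not_lt] at hk
  have h0 : (0 : ℝ) < n := by exact_mod_cast hn
  rw [lt_div_iff₀ h0]
  exact_mod_cast hk

theorem integral_mul_locKernel (hι : Continuous ι) {a : ℝ → ℝ} (ha : ∀ t, 2 < t → a t = 0) {n : ℕ}
    (hn : 1 ≤ n) {f : Ω → ℝ} (hf : Integrable f μ) (x : Ω) :
    ∫ y, f y * locKernel ι μ a n x y ∂μ =
      ∑ k ∈ Finset.range (2 * n + 1), a ((k : ℝ) / (n : ℝ)) * polyProj ι μ k f x := by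
  simp only [locKernel_eq_sum ha hn, Finset.mul_sum, mul_left_comm (f _)]
  rw [integral_finsetSum _ fun k _ => (integrable_mul_continuous hf
    (continuous_reproKernel hι k x)).const_mul _]
  simp only [integral_const_mul, polyProj]

theorem continuous_locKernel (hι : Continuous ι) {a : ℝ → ℝ} (ha : ∀ t, 2 < t → a t = 0) {n : ℕ}
    (hn : 1 ≤ n) (x : Ω) : Continuous (locKernel ι μ a n x) := by
  rw [show locKernel ι μ a n x = _ from funext fun y => locKernel_eq_sum ha hn x y]
  exact continuous_finsetSum _ fun k _ => continuous_const.mul (continuous_reproKernel hι k x)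

/-- The kernels of cut-off functions of type (a) reproduce polynomials. -/
theorem integral_mul_locKernel_eq_self (hι : Continuous ι) {a : ℝ → ℝ}
    (ha : ∀ t, 2 < t → a t = 0) (ha1 : ∀ t ∈ Set.Icc (0 : ℝ) 1, a t = 1) {n : ℕ} (hn : 1 ≤ n)
    {f : Ω → ℝ} (hf : f ∈ polySpace ι n) (x : Ω) :
    ∫ y, f y * locKernel ι μ a n x y ∂μ = f x := by
  rw [integral_mul_locKernel hι ha hn
    (integrable_of_continuous (continuous_of_mem_polySpace hι hf)), ← sum_polyProj (μ := μ) hι hf x]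
  symm
  have h0 : (0 : ℝ) < n := by exact_mod_cast hn
  rw [← Finset.sum_subset (Finset.range_mono (by omega : n + 1 ≤ 2 * n + 1))]
  · refine Finset.sum_congr rfl fun k hk => ?_
    rw [ha1, one_mul]
    refine ⟨by positivity, (div_le_one h0).2 ?_⟩
    exact_mod_cast Nat.lt_succ_iff.1 (Finset.mem_range.1 hk)
  · intro k _ hk
    rw [Finset.mem_range, not_lt] at hk
    rw [polyProj_eq_zero hι (by omega : n < k) hf, Pi.zero_apply, mul_zero]

end Kernels

/-! ### Maximal functions of Peetre type -/

/-- The maximal function `sup_y |f(y)| / (1 + s d(x,y))^K`. -/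
noncomputable def peetre {Ω : Type*} [MetricSpace Ω] (s : ℝ) (K : ℕ) (f : Ω → ℝ) (x : Ω) : ℝ :=
  ⨆ y, |f y| / (1 + s * dist x y) ^ K

section Peetre

variable {Ω : Type*} [MetricSpace Ω] [CompactSpace Ω] {s : ℝ} {K : ℕ} {f : Ω → ℝ}

theorem one_add_mul_dist_le {Ω : Type*} [MetricSpace Ω] {s : ℝ} (hs : 0 ≤ s) (x y z : Ω) :
    1 + s * dist x z ≤ (1 + s * dist x y) * (1 + s * dist y z) := by
  have h1 := mul_le_mul_of_nonneg_left (dist_triangle x y z) hs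
  have h2 : 0 ≤ (s * dist x y) * (s * dist y z) := by positivity
  nlinarith

/-- Compactness makes the supremum finite, so that the real-valued `⨆` is a genuine supremum. -/
theorem abs_le_peetre_mul (hs : 0 ≤ s) (hf : Continuous f) (x y : Ω) :
    |f y| ≤ peetre s K f x * (1 + s * dist x y) ^ K := by
  obtain ⟨C, hC⟩ := isCompact_univ.exists_bound_of_continuousOn hf.continuousOn
  rw [← div_le_iff₀ (by positivity)]
  refine le_ciSup (f := fun y => |f y| / (1 + s * dist x y) ^ K) ⟨C, ?_⟩ y
  rintro _ ⟨u, rfl⟩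
  refine (div_le_self (abs_nonneg _) (one_le_pow₀ ?_)).trans (hC u trivial)
  have : 0 ≤ s * dist x u := by positivity
  linarith

omit [CompactSpace Ω] in
theorem peetre_nonneg (hs : 0 ≤ s) (x : Ω) : 0 ≤ peetre s K f x :=
  Real.iSup_nonneg fun y => by positivity

theorem peetre_le_mul (hs : 0 ≤ s) (hf : Continuous f) (x y : Ω) :
    peetre s K f y ≤ peetre s K f x * (1 + s * dist x y) ^ K := by
  have : Nonempty Ω := ⟨x⟩
  refine ciSup_le fun u => ?_
  rw [div_le_iff₀ (by positivity), mul_assoc, ← mul_pow]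
  exact (abs_le_peetre_mul hs hf x u).trans (mul_le_mul_of_nonneg_left
    (pow_le_pow_left₀ (by positivity) (one_add_mul_dist_le hs x y u) K) (peetre_nonneg hs x))

end Peetre

/-! ### Oscillation of polynomials, pointwise and in `L¹`. -/

section Oscillation

variable {Ω : Type*} [MetricSpace Ω] [CompactSpace Ω] [MeasurableSpace Ω] [BorelSpace Ω]
  {d : ℕ} {ι : Ω → EuclideanSpace ℝ (Fin d)} {m : Measure Ω}

theorem IsDoublingWeight.isOpenPosMeasure {w : Ω → ℝ} (hw : IsDoublingWeight m w)
    (hw1 : ∫ x, w x ∂m = 1) : (weightMeasure m w).IsOpenPosMeasure := by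
  have := isFiniteMeasure_weightMeasure hw.integrable
  obtain ⟨L, hL⟩ := hw.doublingMeasure
  refine hL.isOpenPosMeasure fun h => ?_
  have h1 := weightMeasure_real hw.integrable hw.nonneg MeasurableSet.univ
  rw [h, wmass, setIntegral_univ, hw1] at h1
  simp at h1

/-- There are cut-off functions of type (a). -/
theorem exists_isAdmissible : ∃ a : ℝ → ℝ, IsAdmissible a ∧ (∀ t, 2 < t → a t = 0) ∧
    ∀ t ∈ Set.Icc (0 : ℝ) 1, a t = 1 := by
  have h1 : ∀ t : ℝ, 2 < t → Real.smoothTransition (2 - t) = 0 := fun t ht =>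
    Real.smoothTransition.zero_of_nonpos (by linarith)
  have h2 : ∀ t ∈ Set.Icc (0 : ℝ) 1, Real.smoothTransition (2 - t) = 1 := fun t ht =>
    Real.smoothTransition.one_of_one_le (by linarith [ht.2])
  exact ⟨fun t => Real.smoothTransition (2 - t),
    ⟨Real.smoothTransition.contDiff.comp (contDiff_const.sub contDiff_id),
      fun t => Real.smoothTransition.nonneg _, Or.inl ⟨h1, h2⟩⟩, h1, h2⟩

/-- The local oscillation of polynomials on a localizable space is controlled by the maximal
function. -/
theorem IsLocalizable.exists_osc_le_peetre (hι : Continuous ι) {ϖ : Ω → ℝ}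
    (hϖ : IsLocalizable ι m ϖ) (K : ℕ) :
    ∃ c δ : ℝ, 0 < c ∧ 0 < δ ∧ δ < 1 ∧ ∀ n : ℕ, 1 ≤ n → ∀ f ∈ polySpace ι n, ∀ x₁ x₂ : Ω,
      n * dist x₁ x₂ < δ → |f x₁ - f x₂| ≤ c * (n * dist x₁ x₂) * peetre n K f x₂ := by
  set ν := weightMeasure m ϖ with hν
  have hint := hϖ.doublingWeight.integrable
  have hnn := hϖ.doublingWeight.nonneg
  have : IsFiniteMeasure ν := isFiniteMeasure_weightMeasure hint
  have : ν.IsOpenPosMeasure := hϖ.doublingWeight.isOpenPosMeasure hϖ.normalized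
  obtain ⟨L, hL⟩ := hϖ.doublingWeight.doublingMeasure
  obtain ⟨K₁, C₁, hC₁, hK₁⟩ := hL.exists_integral_decay_le
  obtain ⟨a, ha, ha2, ha1⟩ := exists_isAdmissible
  obtain ⟨δ, hδ0, hδ1, hδ⟩ := hϖ.assertion2 a ha
  -- The exponent `K` compensates the growth of `f` allowed by its maximal function, and `K₁` makes
  -- the rest integrable; the extra `1` only ensures a positive exponent.
  obtain ⟨c, hc⟩ := hδ (K + K₁ + 1 : ℕ) (by positivity)
  refine ⟨(|c| + 1) * (C₁ * √L), δ, by have := hL.1; positivity, hδ0, hδ1,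
    fun n hn f hf x₁ x₂ hx => ?_⟩
  have hn0 : (0 : ℝ) < n := by exact_mod_cast hn
  have hfc := continuous_of_mem_polySpace hι hf
  set P := peetre (n : ℝ) K f x₂
  have hP : 0 ≤ P := peetre_nonneg hn0.le x₂
  set V₁ := ν.real (ball x₁ (1 / n)) with hV₁
  set V₂ := ν.real (ball x₂ (1 / n)) with hV₂
  have hV₁0 : 0 < V₁ := measureReal_ball_pos x₁ (by positivity)
  have hV₂0 : 0 < V₂ := measureReal_ball_pos x₂ (by positivity)
  have hdist : dist x₁ x₂ ≤ 1 / n := by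
    rw [le_div_iff₀ hn0]; linarith
  -- The two centres are within `1 / n`, so by doubling the mixed normalization of the kernel bound
  -- controls the mass `V₂` produced by integrating the decay.
  have hV : V₂ ≤ √L * (√V₁ * √V₂) := by
    have h1 : V₂ ≤ L * V₁ := hL.ball_le_of_dist_le (by positivity) (by rwa [dist_comm])
    have h2 : √V₂ ≤ √L * √V₁ := by
      rw [← Real.sqrt_mul hL.1.le]
      exact Real.sqrt_le_sqrt h1
    calc V₂ = √V₂ * √V₂ := (Real.mul_self_sqrt hV₂0.le).symm
      _ ≤ (√L * √V₁) * √V₂ := mul_le_mul_of_nonneg_right h2 (Real.sqrt_nonneg _)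
      _ = _ := by ring
  have hS : 0 < √V₁ * √V₂ := mul_pos (Real.sqrt_pos.2 hV₁0) (Real.sqrt_pos.2 hV₂0)
  have hLc : ∀ x, Continuous (locKernel ι ν a n x) := continuous_locKernel hι ha2 hn
  have hdiff : f x₁ - f x₂ = ∫ y, f y * (locKernel ι ν a n x₁ y - locKernel ι ν a n x₂ y) ∂ν := by
    simp only [mul_sub]
    rw [integral_sub (integrable_continuous_mul hfc (hLc x₁))
      (integrable_continuous_mul hfc (hLc x₂)),
      integral_mul_locKernel_eq_self hι ha2 ha1 hn hf,
      integral_mul_locKernel_eq_self hι ha2 ha1 hn hf]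
  have hpt : ∀ y, ‖f y * (locKernel ι ν a n x₁ y - locKernel ι ν a n x₂ y)‖ ≤
      (|c| + 1) * (n * dist x₁ x₂) / (√V₁ * √V₂) * P * ((1 + n * dist x₂ y) ^ K₁)⁻¹ := by
    intro y
    have hk := hc n hn δ hδ0 le_rfl x₁ x₂ y (by
      rw [mem_ball, lt_div_iff₀ hn0]; linarith)
    rw [← weightMeasure_real hint hnn measurableSet_ball,
      ← weightMeasure_real hint hnn measurableSet_ball, Real.rpow_natCast] at hk
    have hb : (1 : ℝ) ≤ 1 + n * dist x₂ y := by
      have : 0 ≤ n * dist x₂ y := by positivity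
      linarith
    have hk' : |locKernel ι ν a n x₁ y - locKernel ι ν a n x₂ y| ≤
        (|c| + 1) * (n * dist x₁ x₂) / (√V₁ * √V₂ * (1 + n * dist x₂ y) ^ (K + K₁)) := by
      refine hk.trans ?_
      refine div_le_div₀ (by positivity) ?_ (by positivity) ?_
      · exact mul_le_mul_of_nonneg_right (by linarith [le_abs_self c]) (by positivity)
      · exact mul_le_mul_of_nonneg_left (pow_le_pow_right₀ hb (by omega)) hS.le
    rw [norm_mul, Real.norm_eq_abs, Real.norm_eq_abs]
    calc |f y| * |locKernel ι ν a n x₁ y - locKernel ι ν a n x₂ y|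
        ≤ (P * (1 + n * dist x₂ y) ^ K) *
          ((|c| + 1) * (n * dist x₁ x₂) / (√V₁ * √V₂ * (1 + n * dist x₂ y) ^ (K + K₁))) :=
          mul_le_mul (abs_le_peetre_mul hn0.le hfc x₂ y) hk' (abs_nonneg _) (by positivity)
      _ = _ := by
          rw [pow_add]
          field_simp
  calc |f x₁ - f x₂| = ‖∫ y, f y * (locKernel ι ν a n x₁ y - locKernel ι ν a n x₂ y) ∂ν‖ := by
        rw [hdiff, Real.norm_eq_abs]
    _ ≤ ∫ y, (|c| + 1) * (n * dist x₁ x₂) / (√V₁ * √V₂) * P * ((1 + n * dist x₂ y) ^ K₁)⁻¹ ∂ν :=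
        norm_integral_le_of_norm_le
          ((integrable_of_continuous (continuous_decay_right hn0.le K₁ x₂)).const_mul _)
          (Eventually.of_forall hpt)
    _ ≤ (|c| + 1) * (n * dist x₁ x₂) / (√V₁ * √V₂) * P * (C₁ * V₂) := by
        rw [integral_const_mul]
        exact mul_le_mul_of_nonneg_left (hK₁ n hn0 x₂) (by positivity)
    _ ≤ (|c| + 1) * (n * dist x₁ x₂) / (√V₁ * √V₂) * P * (C₁ * (√L * (√V₁ * √V₂))) :=
        mul_le_mul_of_nonneg_left (mul_le_mul_of_nonneg_left hV hC₁.le) (by positivity)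
    _ = (|c| + 1) * (C₁ * √L) * (n * dist x₁ x₂) * P := by field_simp

theorem continuous_integral_of_continuous {μ : Measure Ω} [IsFiniteMeasure μ] {F : Ω → Ω → ℝ}
    (hF : Continuous F.uncurry) : Continuous fun x => ∫ y, F x y ∂μ := by
  simpa using continuous_parametric_integral_of_continuous (μ := μ) hF isCompact_univ

/-- The `L¹` oscillation of polynomials is controlled by the `L¹` norm for doubling measures. -/
theorem IsLocalizable.exists_osc_le (hι : Continuous ι) {ϖ : Ω → ℝ} (hϖ : IsLocalizable ι m ϖ)
    {μ : Measure Ω} [IsFiniteMeasure μ] [μ.IsOpenPosMeasure] {L : ℝ} (hμ : DoublingMeasure μ L) :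
    ∃ C δ : ℝ, 0 < C ∧ 0 < δ ∧ ∀ n : ℕ, 1 ≤ n → ∀ f ∈ polySpace ι n,
      ∃ I : Ω → ℝ, Continuous I ∧ (∀ x, 0 ≤ I x) ∧ ∫ x, I x ∂μ ≤ C * ∫ x, |f x| ∂μ ∧
        ∀ x₁ x₂ : Ω, n * dist x₁ x₂ < δ → |f x₁ - f x₂| ≤ n * dist x₁ x₂ * I x₂ := by
  -- The order of the maximal function is dictated by `μ`, while the oscillation estimate that uses
  -- it comes from `ϖ`.
  obtain ⟨K, C₁, hC₁, hK⟩ := hμ.exists_integral_decay_le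
  obtain ⟨c, δ, hc, hδ0, hδ1, hosc⟩ := hϖ.exists_osc_le_peetre hι K
  -- the small radius on which the oscillation is absorbed
  set t := min δ (1 / (2 * c)) with ht
  have ht0 : 0 < t := lt_min hδ0 (by positivity)
  have ht1 : t < 1 := (min_le_left _ _).trans_lt hδ1
  have htc : c * t ≤ 1 / 2 := by
    calc c * t ≤ c * (1 / (2 * c)) := mul_le_mul_of_nonneg_left (min_le_right _ _) hc.le
      _ = 1 / 2 := by field_simp
  obtain ⟨C₂, hC₂, hball⟩ := hμ.exists_ball_le ht0
  have hL0 := hμ.1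
  set A := 2 ^ K * (C₁ * L * C₂) with hA
  have hA0 : 0 < A := by positivity
  refine ⟨c * (2 * A), δ, by positivity, hδ0, fun n hn f hf => ?_⟩
  have hn0 : (0 : ℝ) < n := by exact_mod_cast hn
  have hfc := continuous_of_mem_polySpace hι hf
  have hD := continuous_decay (Ω := Ω) hn0.le K
  set D : Ω → Ω → ℝ := fun x y => ((1 + n * dist x y) ^ K)⁻¹ with hDdef
  have hD0 : ∀ x y, 0 < D x y := fun x y => by positivity
  have hDx : ∀ x, Continuous (D x) := continuous_decay_right hn0.le K
  set h : Ω → ℝ := fun u => ∫ v, D u v ∂μ with hh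
  have hhc : Continuous h := continuous_integral_of_continuous hD
  have hh0 : ∀ u, 0 < h u := fun u => by
    have : 0 ≤ h u := integral_nonneg fun v => (hD0 u v).le
    refine this.lt_of_ne' fun h0 => ?_
    have h1 := (integral_eq_zero_iff_of_nonneg (fun v => (hD0 u v).le)
      (integrable_of_continuous (hDx u))).1 h0
    exact (hD0 u u).ne' (congrFun ((Continuous.ae_eq_iff_eq μ (hDx u) continuous_zero).1 h1) u)
  -- Dividing by `h u`, the total mass of the symmetric kernel `D` at `u`, makes the `x`-integral of
  -- `F x u` exactly `|f u|`. Fubini then gives the `L¹` bound without a maximal theorem.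
  set F : Ω → Ω → ℝ := fun x u => |f u| / h u * D x u with hF
  have hFc : Continuous F.uncurry :=
    ((hfc.abs.div hhc fun u => (hh0 u).ne').comp continuous_snd).mul hD
  have hF0 : ∀ x u, 0 ≤ F x u := fun x u =>
    mul_nonneg (div_nonneg (abs_nonneg _) (hh0 u).le) (hD0 x u).le
  have hFx : ∀ x, Integrable (F x) μ := fun x =>
    integrable_of_continuous (hFc.comp (by fun_prop : Continuous fun u => (x, u)))
  have hJc : Continuous fun x => ∫ u, F x u ∂μ := continuous_integral_of_continuous hFc
  have hJ0 : ∀ x, 0 ≤ ∫ u, F x u ∂μ := fun x => integral_nonneg (hF0 x)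
  have hJint : ∫ x, ∫ u, F x u ∂μ ∂μ = ∫ u, |f u| ∂μ := by
    rw [integral_integral_swap_of_hasCompactSupport hFc (HasCompactSupport.of_compactSpace _)]
    refine integral_congr_ae (Eventually.of_forall fun u => ?_)
    simp only [hF]
    rw [integral_const_mul]
    have : ∫ x, D x u ∂μ = h u := by
      simp only [hh, hDdef, dist_comm]
    rw [this, div_mul_cancel₀ _ (hh0 u).ne']
  have hP : ∀ x, peetre n K f x ≤ 2 * A * ∫ u, F x u ∂μ := by
    intro x
    have hne : Nonempty Ω := ⟨x⟩
    set P := peetre (n : ℝ) K f x with hPdef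
    have hP0 : 0 ≤ P := peetre_nonneg hn0.le x
    -- The radius `t / n` was chosen so that `c * t ≤ 1 / 2`: the oscillation around `y` costs at
    -- most half of the maximal function, which is absorbed on the left.
    suffices H : P ≤ A * (∫ u, F x u ∂μ) + 1 / 2 * P by linarith
    refine ciSup_le fun y => ?_
    set Q := |f y| / (1 + n * dist x y) ^ K with hQ
    set B := ball y (t * (1 / n)) with hB
    have hBpos : 0 < μ.real B := measureReal_ball_pos y (by positivity)
    have hpt : ∀ u ∈ B, Q - 1 / 2 * P ≤ A * μ.real B * F x u := by
      intro u hu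
      have hdu : n * dist u y < t := by
        rw [hB, mem_ball, mul_one_div, lt_div_iff₀ hn0] at hu; linarith
      have hduδ : n * dist u y < δ := hdu.trans_le (min_le_left _ _)
      have h1 : |f y| ≤ |f u| + 1 / 2 * peetre n K f y := by
        have h2 := hosc n hn f hf u y hduδ
        have h3 : c * (n * dist u y) ≤ 1 / 2 :=
          (mul_le_mul_of_nonneg_left hdu.le hc.le).trans htc
        have h4 := mul_le_mul_of_nonneg_right h3 (peetre_nonneg (K := K) (f := f) hn0.le y)
        have h5 := abs_sub_abs_le_abs_sub (f y) (f u)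
        rw [abs_sub_comm] at h5
        linarith
      have h6 := peetre_le_mul (K := K) hn0.le hfc x y
      have h7 : Q ≤ |f u| / (1 + n * dist x y) ^ K + 1 / 2 * P := by
        rw [hQ, div_le_iff₀ (by positivity), add_mul, div_mul_cancel₀ _ (by positivity)]
        linarith
      have h8 : |f u| / (1 + n * dist x y) ^ K ≤ |f u| * (2 ^ K * D x u) := by
        rw [div_eq_mul_inv]
        refine mul_le_mul_of_nonneg_left ?_ (abs_nonneg _)
        rw [hDdef, ← div_eq_mul_inv, inv_le_comm₀ (by positivity) (by positivity), inv_div,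
          ← div_pow]
        refine pow_le_pow_left₀ (by positivity) ?_ K
        have h9 := one_add_mul_dist_le hn0.le x y u
        rw [dist_comm y u] at h9
        have h10 : 0 ≤ n * dist x y := by positivity
        rw [div_le_iff₀ two_pos]
        nlinarith
      -- By doubling, `h u` is at most a constant times the mass of `B`, so integrating the
      -- pointwise bound over `B` cancels that mass.
      have h11 : h u ≤ C₁ * L * C₂ * μ.real B := by
        have e1 := hK n hn0 u
        have e2 : μ.real (ball u (1 / n)) ≤ L * μ.real (ball y (1 / n)) := by
          refine hμ.ball_le_of_dist_le (by positivity) ?_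
          rw [le_div_iff₀ hn0]; linarith
        have e3 := hball y (1 / n) (by positivity)
        calc h u ≤ C₁ * (L * (C₂ * μ.real B)) := e1.trans (mul_le_mul_of_nonneg_left
              (e2.trans (mul_le_mul_of_nonneg_left e3 hL0.le)) hC₁.le)
          _ = _ := by ring
      have h12 : |f u| * (2 ^ K * D x u) ≤ A * μ.real B * F x u := by
        have e1 : 1 ≤ C₁ * L * C₂ * μ.real B / h u := (one_le_div (hh0 u)).2 h11
        calc |f u| * (2 ^ K * D x u) = |f u| * (2 ^ K * D x u) * 1 := by ring
          _ ≤ |f u| * (2 ^ K * D x u) * (C₁ * L * C₂ * μ.real B / h u) :=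
              mul_le_mul_of_nonneg_left e1 (by have := hD0 x u; positivity)
          _ = A * μ.real B * F x u := by rw [hA, hF]; ring
      linarith
    have h13 : (Q - 1 / 2 * P) * μ.real B ≤ A * μ.real B * ∫ u, F x u ∂μ := by
      calc (Q - 1 / 2 * P) * μ.real B = ∫ u in B, (Q - 1 / 2 * P) ∂μ := by
            rw [setIntegral_const, smul_eq_mul, mul_comm]
        _ ≤ ∫ u in B, A * μ.real B * F x u ∂μ :=
            setIntegral_mono_on (integrable_const _) ((hFx x).const_mul _).integrableOn
              measurableSet_ball hpt
        _ ≤ ∫ u, A * μ.real B * F x u ∂μ :=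
            setIntegral_le_integral ((hFx x).const_mul _) (Eventually.of_forall fun u =>
              mul_nonneg (by positivity) (hF0 x u))
        _ = _ := integral_const_mul _ _
    have h14 : Q - 1 / 2 * P ≤ A * ∫ u, F x u ∂μ := by
      refine le_of_mul_le_mul_right ?_ hBpos
      linarith
    linarith
  refine ⟨fun x => c * (2 * A) * ∫ u, F x u ∂μ, continuous_const.mul hJc,
    fun x => mul_nonneg (by positivity) (hJ0 x), ?_, fun x₁ x₂ hx => ?_⟩
  · rw [integral_const_mul, hJint]
  · calc |f x₁ - f x₂| ≤ c * (n * dist x₁ x₂) * peetre n K f x₂ := hosc n hn f hf x₁ x₂ hx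
      _ ≤ c * (n * dist x₁ x₂) * (2 * A * ∫ u, F x₂ u ∂μ) :=
          mul_le_mul_of_nonneg_left (hP x₂) (by positivity)
      _ = _ := by ring

end Oscillation

/-! ### Positive cubature rules -/

section Cubature

/-- A Farkas lemma for functionals on function spaces containing the constants: a functional that
dominates `∑ Λ_z f(z)` on functions that are nonnegative on `Ξ` is a sum of point evaluations with
weights at least `Λ_z`. -/
theorem exists_weights_of_dominates {X : Type*} {V : Submodule ℝ (X → ℝ)}
    (hV : (fun _ => 1) ∈ V) (ℓ : V →ₗ[ℝ] ℝ) (Ξ : Finset X) (Λ : X → ℝ)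
    (h : ∀ f : V, (∀ z ∈ Ξ, 0 ≤ f.1 z) → ∑ z ∈ Ξ, Λ z * f.1 z ≤ ℓ f) :
    ∃ lam : X → ℝ, (∀ z ∈ Ξ, Λ z ≤ lam z) ∧ ∀ f : V, ℓ f = ∑ z ∈ Ξ, lam z * f.1 z := by
  classical
  -- The excess `ℓ - ∑ Λ_z f(z)` is nonnegative on the functions of `V` in this cone. The M. Riesz
  -- theorem extends it to all functions on `X`; the constants in `V` supply the required
  -- cofinality.
  let s : PointedCone ℝ (X → ℝ) :=
    { carrier := {f | ∀ z ∈ Ξ, 0 ≤ f z}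
      add_mem' := fun hf hg z hz => add_nonneg (hf z hz) (hg z hz)
      zero_mem' := fun z _ => le_rfl
      smul_mem' := fun c f hf z hz => mul_nonneg c.2 (hf z hz) }
  have hs : ∀ f : X → ℝ, f ∈ s ↔ ∀ z ∈ Ξ, 0 ≤ f z := fun f => Iff.rfl
  let φ : V →ₗ[ℝ] ℝ := ℓ - ∑ z ∈ Ξ, Λ z • (LinearMap.proj z).comp V.subtype
  have hφ : ∀ f : V, φ f = ℓ f - ∑ z ∈ Ξ, Λ z * f.1 z := fun f => by
    simp [φ, LinearMap.sum_apply]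
  obtain ⟨g, hg1, hg2⟩ := riesz_extension s ⟨V, φ⟩
    (fun f hf => by
      change 0 ≤ φ f
      rw [hφ, sub_nonneg]
      exact h f hf)
    (fun y => by
      refine ⟨⟨(∑ z ∈ Ξ, |y z|) • (fun _ => 1), V.smul_mem _ hV⟩, fun z hz => ?_⟩
      have h1 := Finset.single_le_sum (f := fun z => |y z|) (fun i _ => abs_nonneg _) hz
      have h2 := neg_abs_le (y z)
      simp only [Pi.add_apply, Pi.smul_apply, smul_eq_mul, mul_one]
      linarith)
  -- Such an `f` and its negative both lie in the cone. Hence `g` sees only the values on `Ξ` and is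
  -- a combination of point evaluations.
  have hzero : ∀ f : X → ℝ, (∀ z ∈ Ξ, f z = 0) → g f = 0 := by
    intro f hf
    have h1 := hg2 f fun z hz => (hf z hz).ge
    have h2 := hg2 (-f) fun z hz => by rw [Pi.neg_apply, hf z hz, neg_zero]
    rw [map_neg] at h2
    linarith
  have hrep : ∀ f : X → ℝ, g f = ∑ z ∈ Ξ, g (Pi.single z 1) * f z := by
    intro f
    have h1 := hzero (f - ∑ z ∈ Ξ, f z • Pi.single z (1 : ℝ)) fun z hz => by
      simp only [Pi.sub_apply, Finset.sum_apply, Pi.smul_apply, smul_eq_mul, Pi.single_apply]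
      simp [hz]
    rw [map_sub, map_sum, sub_eq_zero] at h1
    rw [h1]
    exact Finset.sum_congr rfl fun z _ => by rw [map_smul, smul_eq_mul, mul_comm]
  refine ⟨fun z => Λ z + g (Pi.single z 1), fun z _ => ?_, fun f => ?_⟩
  · have : 0 ≤ g (Pi.single z 1) := hg2 _ fun y _ => by
      rw [Pi.single_apply]
      split_ifs <;> norm_num
    linarith
  · have h1 : g f.1 = φ f := hg1 f
    rw [hrep, hφ] at h1
    simp only [add_mul, Finset.sum_add_distrib]
    linarith

variable {Ω : Type*} [MetricSpace Ω] [MeasurableSpace Ω] [OpensMeasurableSpace Ω]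

/-- Measurable partitions of unity subordinate to the balls around a separated set. -/
theorem IsMaximalSeparated.exists_partition {ε : ℝ} {Ξ : Finset Ω}
    (hΞ : IsMaximalSeparated ε Ξ) :
    ∃ φ : Ω → Ω → ℝ, (∀ z, Measurable (φ z)) ∧ (∀ z x, 0 ≤ φ z x) ∧
      (∀ z x, φ z x ≠ 0 → dist x z < ε) ∧
      (∀ z, ∀ x ∈ ball z (ε / 2), 1 ≤ φ z x) ∧ ∀ x, ∑ z ∈ Ξ, φ z x = 1 := by
  obtain ⟨hsep, c, -, hcov⟩ := hΞ
  set N : Ω → ℝ := fun x => ∑ z ∈ Ξ, (ball z ε).indicator (fun _ => (1 : ℝ)) x with hN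
  have hNm : Measurable N := Finset.measurable_fun_sum _ fun z _ =>
    measurable_const.indicator measurableSet_ball
  set U : Set Ω := ⋃ z ∈ Ξ, ball z (ε / 2) with hU
  have hUm : MeasurableSet U := Finset.measurableSet_biUnion _ fun z _ => measurableSet_ball
  have hN0 : ∀ x, 0 ≤ (N x)⁻¹ := fun x => inv_nonneg.2 (zero_le_one.trans (hcov x).1)
  -- By separation the half balls are disjoint, so each can be given entirely to its centre;
  -- remaining points are shared equally among the balls covering them. The lower bound on `∫ φ z`
  -- is thus independent of the overlap constant `c`, which may vary with `Ξ`.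
  refine ⟨fun z x => (ball z (ε / 2)).indicator (fun _ => 1) x +
    (ball z ε \ U).indicator (fun x => (N x)⁻¹) x, fun z => ?_, fun z x => ?_, fun z x h => ?_,
    fun z x hx => ?_, fun x => ?_⟩
  · exact (measurable_const.indicator measurableSet_ball).add
      (hNm.inv.indicator (measurableSet_ball.diff hUm))
  · exact add_nonneg (Set.indicator_nonneg (fun _ _ => zero_le_one) _)
      (Set.indicator_nonneg (fun x _ => hN0 x) _)
  · by_contra hx
    rw [not_lt] at hx
    refine h ?_
    dsimp only
    rw [Set.indicator_of_notMem, Set.indicator_of_notMem, add_zero]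
    · exact fun hm => hx.not_gt (mem_ball.1 hm.1)
    · intro hm
      have := mem_ball.1 hm
      have := dist_nonneg (x := x) (y := z)
      linarith
  · simp only [Set.indicator_of_mem hx]
    exact le_add_of_nonneg_right (Set.indicator_nonneg (fun x _ => hN0 x) _)
  · rw [Finset.sum_add_distrib]
    by_cases hx : x ∈ U
    · have hx' := hx
      simp only [hU, Set.mem_iUnion] at hx'
      obtain ⟨z, hz, hxz⟩ := hx'
      have h1 : ∀ y ∈ Ξ, (ball y ε \ U).indicator (fun x => (N x)⁻¹) x = 0 := fun y _ =>
        Set.indicator_of_notMem (fun h => h.2 hx) _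
      rw [Finset.sum_eq_zero h1, add_zero, Finset.sum_eq_single_of_mem z hz,
        Set.indicator_of_mem hxz]
      intro y hy hyz
      refine Set.indicator_of_notMem (fun hxy => ?_) _
      have h2 := hsep y hy z hz hyz
      have h3 := dist_triangle_left y z x
      rw [mem_ball] at hxy hxz
      linarith
    · have h1 : ∀ y ∈ Ξ, (ball y (ε / 2)).indicator (fun _ => (1 : ℝ)) x = 0 := fun y hy =>
        Set.indicator_of_notMem (fun h => hx (Set.mem_biUnion hy h)) _
      have h2 : ∀ y ∈ Ξ, (ball y ε \ U).indicator (fun x => (N x)⁻¹) x =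
          (ball y ε).indicator (fun _ => (1 : ℝ)) x * (N x)⁻¹ := by
        intro y _
        by_cases hy : x ∈ ball y ε
        · rw [Set.indicator_of_mem (Set.mem_sdiff_of_mem hy hx), Set.indicator_of_mem hy,
            one_mul]
        · rw [Set.indicator_of_notMem (fun h => hy h.1), Set.indicator_of_notMem hy, zero_mul]
      rw [Finset.sum_eq_zero h1, zero_add, Finset.sum_congr rfl h2, ← Finset.sum_mul]
      exact mul_inv_cancel₀ (zero_lt_one.trans_le (hcov x).1).ne'

end Cubature

/-! ### Existence of cubature weights and their upper bound. -/

section Existence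

variable {Ω : Type*} [MetricSpace Ω] [CompactSpace Ω] [MeasurableSpace Ω] [BorelSpace Ω]
  {d : ℕ} {ι : Ω → EuclideanSpace ℝ (Fin d)} {m : Measure Ω} {μ : Measure Ω} [IsFiniteMeasure μ]
  [μ.IsOpenPosMeasure] {L : ℝ}

/-- Cubature rules with positive weights exist on sufficiently dense separated sets. -/
theorem IsLocalizable.exists_cubature (hι : Continuous ι) {ϖ : Ω → ℝ} (hϖ : IsLocalizable ι m ϖ)
    (hμ : DoublingMeasure μ L) :
    ∃ δ : ℝ, 0 < δ ∧ ∀ (n : ℕ) (ε : ℝ) (Ξ : Finset Ω), 1 ≤ n → 0 < ε → n * ε ≤ δ →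
      IsMaximalSeparated ε Ξ →
      ∃ lam : Ω → ℝ, (∀ z ∈ Ξ, 1 / 2 * μ.real (ball z (ε / 2)) ≤ lam z) ∧
        ∀ f ∈ polySpace ι n, ∫ x, f x ∂μ = ∑ z ∈ Ξ, lam z * f z := by
  obtain ⟨C, δ, hC, hδ, hosc⟩ := hϖ.exists_osc_le hι hμ
  -- The second bound makes the `L¹` distance between `f` and `∑ φ_z f(z)` at most a quarter of `∫
  -- |f|`.
  refine ⟨min δ (1 / (4 * C)), lt_min hδ (by positivity), fun n ε Ξ hn hε hnε hΞ => ?_⟩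
  have hn0 : (0 : ℝ) < n := by exact_mod_cast hn
  obtain ⟨φ, hφm, hφ0, hφs, hφ1, hφsum⟩ := hΞ.exists_partition
  have hφint : ∀ z ∈ Ξ, Integrable (φ z) μ := fun z hz =>
    Integrable.of_bound (hφm z).aestronglyMeasurable 1 (Eventually.of_forall fun x => by
      rw [Real.norm_of_nonneg (hφ0 z x), ← hφsum x]
      exact Finset.single_le_sum (f := fun z => φ z x) (fun y _ => hφ0 y x) hz)
  have hint : ∀ {f}, f ∈ polySpace ι n → Integrable f μ := fun hf =>
    integrable_of_continuous (continuous_of_mem_polySpace hι hf)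
  let ℓ : polySpace ι n →ₗ[ℝ] ℝ :=
    { toFun := fun f => ∫ x, f.1 x ∂μ
      map_add' := fun f g => integral_add (hint f.2) (hint g.2)
      map_smul' := fun c f => integral_const_mul _ _ }
  obtain ⟨lam, h1, h2⟩ := exists_weights_of_dominates (const_mem_polySpace (ι := ι) 1 n) ℓ Ξ
    (fun z => 1 / 2 * ∫ x, φ z x ∂μ) (by
      rintro ⟨f, hf⟩ hf0
      change _ ≤ ∫ x, f x ∂μ
      dsimp only at hf0 ⊢
      obtain ⟨I, hIc, hI0, hI, hfI⟩ := hosc n hn f hf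
      have hfi := hint hf
      set g : Ω → ℝ := fun x => ∑ z ∈ Ξ, φ z x * f z with hg
      have hgi : Integrable g μ := integrable_finsetSum _ fun z hz => (hφint z hz).mul_const _
      have hg0 : ∀ x, 0 ≤ g x := fun x =>
        Finset.sum_nonneg fun z hz => mul_nonneg (hφ0 z x) (hf0 z hz)
      have hGint : ∫ x, g x ∂μ = ∑ z ∈ Ξ, (∫ x, φ z x ∂μ) * f z := by
        rw [hg, integral_finsetSum _ fun z hz => (hφint z hz).mul_const _]
        simp only [integral_mul_const]
      have hpt : ∀ x, |f x - g x| ≤ n * ε * I x := by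
        intro x
        have e1 : f x - g x = ∑ z ∈ Ξ, φ z x * (f x - f z) := by
          simp only [mul_sub, Finset.sum_sub_distrib, ← Finset.sum_mul, hφsum x, one_mul, hg]
        calc |f x - g x| ≤ ∑ z ∈ Ξ, |φ z x * (f x - f z)| := by
              rw [e1]; exact Finset.abs_sum_le_sum_abs _ _
          _ ≤ ∑ z ∈ Ξ, φ z x * (n * ε * I x) := by
              refine Finset.sum_le_sum fun z _ => ?_
              rw [abs_mul, abs_of_nonneg (hφ0 z x)]
              by_cases hz : φ z x = 0
              · simp [hz]
              · refine mul_le_mul_of_nonneg_left ?_ (hφ0 z x)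
                have hd : dist z x < ε := by rw [dist_comm]; exact hφs z x hz
                have hnd : n * dist z x < n * ε := mul_lt_mul_of_pos_left hd hn0
                rw [abs_sub_comm]
                exact (hfI z x (hnd.trans_le (hnε.trans (min_le_left _ _)))).trans
                  (mul_le_mul_of_nonneg_right hnd.le (hI0 x))
          _ = n * ε * I x := by rw [← Finset.sum_mul, hφsum, one_mul]
      have hIi : Integrable I μ := integrable_of_continuous hIc
      set S := ∫ x, |f x| ∂μ with hS
      have hS0 : 0 ≤ S := integral_nonneg fun x => abs_nonneg _
      have hsmall : n * ε * ∫ x, I x ∂μ ≤ 1 / 4 * S := by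
        calc n * ε * ∫ x, I x ∂μ ≤ n * ε * (C * S) := mul_le_mul_of_nonneg_left hI (by positivity)
          _ ≤ 1 / (4 * C) * (C * S) :=
              mul_le_mul_of_nonneg_right (hnε.trans (min_le_right _ _)) (by positivity)
          _ = 1 / 4 * S := by field_simp
      have e1 : ∫ x, g x ∂μ - ∫ x, f x ∂μ ≤ 1 / 4 * S := by
        rw [← integral_sub hgi hfi]
        refine le_trans ?_ hsmall
        rw [← integral_const_mul]
        exact integral_mono (hgi.sub hfi) (hIi.const_mul _) fun x => by
          have := (abs_le.1 (hpt x)).1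
          beta_reduce
          linarith
      have e2 : S - ∫ x, g x ∂μ ≤ 1 / 4 * S := by
        rw [hS, ← integral_sub hfi.abs hgi]
        refine le_trans ?_ hsmall
        rw [← integral_const_mul]
        exact integral_mono (hfi.abs.sub hgi) (hIi.const_mul _) fun x => by
          have h5 := abs_sub_abs_le_abs_sub (f x) (g x)
          rw [abs_of_nonneg (hg0 x)] at h5
          exact h5.trans (hpt x)
      have e3 : ∑ z ∈ Ξ, 1 / 2 * (∫ x, φ z x ∂μ) * f z = 1 / 2 * ∫ x, g x ∂μ := by
        rw [hGint, Finset.mul_sum]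
        exact Finset.sum_congr rfl fun z _ => by ring
      rw [e3]
      -- `e2` gives `S ≤ 4/3 * ∫ g`, and then `e1` gives `∫ f ≥ 2/3 * ∫ g ≥ 1/2 * ∫ g`.
      linarith)
  refine ⟨lam, fun z hz => le_trans ?_ (h1 z hz), fun f hf => h2 ⟨f, hf⟩⟩
  refine mul_le_mul_of_nonneg_left ?_ (by norm_num)
  rw [← integral_indicator_one measurableSet_ball]
  refine integral_mono ((integrable_const _).indicator measurableSet_ball) (hφint z hz) fun x => ?_
  by_cases hx : x ∈ ball z (ε / 2)
  · rw [Set.indicator_of_mem hx]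
    exact hφ1 z x hx
  · rw [Set.indicator_of_notMem hx]
    exact hφ0 z x

omit [μ.IsOpenPosMeasure] in
/-- Weights of positive cubature rules are bounded by the masses of balls if there are fast decaying
polynomials. -/
theorem exists_weight_le (hι : Continuous ι) (h4 : Assertion4 ι) (hμ : DoublingMeasure μ L) :
    ∃ c : ℝ, 0 < c ∧ ∀ (n : ℕ) (Ξ : Finset Ω) (lam : Ω → ℝ), 1 ≤ n → (∀ z ∈ Ξ, 0 ≤ lam z) →
      (∀ f ∈ polySpace ι n, ∫ x, f x ∂μ = ∑ z ∈ Ξ, lam z * f z) →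
      ∀ z ∈ Ξ, lam z ≤ c * μ.real (ball z (1 / n)) := by
  obtain ⟨K, C, hC, hK⟩ := hμ.exists_integral_decay_le
  -- The order `K + 2` exceeds `1`, as `Assertion4` demands, and is at least the order `K` needed
  -- for integrability.
  obtain ⟨_, c, _, _, _, -, -, -, -, hT⟩ := h4 ((K + 2 : ℕ) : ℝ)
    (by exact_mod_cast (by omega : 1 < K + 2))
  refine ⟨(|c| + 1) * C, by positivity, fun n Ξ lam hn hlam hcub z hz => ?_⟩
  have hn0 : (0 : ℝ) < n := by exact_mod_cast hn
  obtain ⟨T, -, h, -⟩ := hT n hn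
  obtain ⟨hTp, hTz, -, hTd⟩ := h z
  -- All terms of the cubature sum for `T z` are nonnegative, and the one at `z` equals `lam z`.
  have h1 : lam z ≤ ∫ x, T z x ∂μ := by
    rw [hcub _ hTp]
    have := Finset.single_le_sum (f := fun y => lam y * T z y)
      (fun y hy => mul_nonneg (hlam y hy) (hTd y).1) hz
    simpa [hTz] using this
  refine h1.trans ?_
  calc ∫ x, T z x ∂μ ≤ ∫ x, (|c| + 1) * ((1 + n * dist z x) ^ K)⁻¹ ∂μ := by
        refine integral_mono (integrable_of_continuous (continuous_of_mem_polySpace hι hTp))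
          ((integrable_of_continuous (continuous_decay_right hn0.le K z)).const_mul _) fun x => ?_
        refine (hTd x).2.trans ?_
        have hb : (1 : ℝ) ≤ 1 + n * dist z x := by
          have : 0 ≤ n * dist z x := by positivity
          linarith
        rw [Real.rpow_neg (by positivity), Real.rpow_natCast]
        refine mul_le_mul (by linarith [le_abs_self c]) ?_ (by positivity) (by positivity)
        exact inv_anti₀ (by positivity) (pow_le_pow_right₀ hb (by omega))
    _ ≤ (|c| + 1) * C * μ.real (ball z (1 / n)) := by
        rw [integral_const_mul, mul_assoc]
        exact mul_le_mul_of_nonneg_left (hK n hn0 z) (by positivity)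

end Existence

/-! ### Orthogonal expansions -/

section Expansion

variable {Ω : Type*} [MetricSpace Ω] [CompactSpace Ω] [MeasurableSpace Ω] [BorelSpace Ω]
  {d : ℕ} {ι : Ω → EuclideanSpace ℝ (Fin d)} {μ : Measure Ω} [IsFiniteMeasure μ]

theorem memLp_of_continuous {f : Ω → ℝ} (hf : Continuous f) : MemLp f 2 μ := by
  obtain ⟨C, hC⟩ := isCompact_univ.exists_bound_of_continuousOn hf.continuousOn
  exact MemLp.of_bound hf.aestronglyMeasurable C (Eventually.of_forall fun x => hC x trivial)

omit [CompactSpace Ω] [MetricSpace Ω] [BorelSpace Ω] [IsFiniteMeasure μ] in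
theorem integrable_mul_self {f : Ω → ℝ} (hf : MemLp f 2 μ) :
    Integrable (fun x => f x * f x) μ :=
  hf.integrable_mul hf

omit [CompactSpace Ω] [MetricSpace Ω] [BorelSpace Ω] [IsFiniteMeasure μ] in
theorem eLpNorm_two_eq {f : Ω → ℝ} (hf : MemLp f 2 μ) :
    eLpNorm f 2 μ = ENNReal.ofReal √(∫ x, f x * f x ∂μ) := by
  rw [hf.eLpNorm_eq_integral_rpow_norm two_ne_zero ENNReal.ofNat_ne_top, Real.sqrt_eq_rpow]
  simp [← pow_two]

omit [MeasurableSpace Ω] [BorelSpace Ω] in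
/-- Polynomials are dense in `C(Ω)`. -/
theorem exists_polySpace_near (hι : IsEmbedding ι) {g : Ω → ℝ} (hg : Continuous g) {ε : ℝ}
    (hε : 0 < ε) : ∃ n, ∃ p ∈ polySpace ι n, ∀ x, |p x - g x| < ε := by
  let X : Fin d → C(Ω, ℝ) := fun i => ⟨fun x => ι x i, by have := hι.continuous; fun_prop⟩
  have hX : ∀ (p : MvPolynomial (Fin d) ℝ) (x : Ω),
      MvPolynomial.aeval X p x = MvPolynomial.eval (fun i => ι x i) p := by
    intro p x
    induction p using MvPolynomial.induction_on with
    | C c => simp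
    | add p q hp hq => simp [hp, hq]
    | mul_X p i hp => simp [hp, X]
  have hsep : (MvPolynomial.aeval (R := ℝ) X).range.SeparatesPoints := by
    intro x y hxy
    have : ι x ≠ ι y := fun h => hxy (hι.injective h)
    obtain ⟨i, hi⟩ : ∃ i, ι x i ≠ ι y i := by
      by_contra! h
      exact this (by ext i; exact h i)
    exact ⟨X i, ⟨X i, ⟨MvPolynomial.X i, by simp⟩, rfl⟩, hi⟩
  obtain ⟨⟨_, p, rfl⟩, hp⟩ :=
    ContinuousMap.exists_mem_subalgebra_near_continuous_of_separatesPoints _ hsep g hg ε hε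
  exact ⟨p.totalDegree, fun x => MvPolynomial.eval (fun i => ι x i) p,
    mem_polySpace.2 ⟨p, le_rfl, fun x => rfl⟩, fun x => by
      have := hp x
      beta_reduce
      rw [← hX, ← Real.norm_eq_abs]
      exact this⟩

/-- Polynomials are dense in `L²(μ)`. -/
theorem exists_polySpace_integral_le (hι : IsEmbedding ι) {f : Ω → ℝ} (hf : MemLp f 2 μ) {ε : ℝ}
    (hε : 0 < ε) :
    ∃ n, ∃ p ∈ polySpace ι n, ∫ x, (f x - p x) * (f x - p x) ∂μ ≤ ε := by
  obtain ⟨g, hg, hgL⟩ := MemLp.exists_boundedContinuous_integral_rpow_sub_le (p := 2) (μ := μ)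
    (f := f) two_pos (by simpa using hf) (ε := ε / 4) (by positivity)
  set M := μ.real Set.univ with hM
  have hM0 : 0 ≤ M := measureReal_nonneg
  obtain ⟨n, p, hp, hpg⟩ := exists_polySpace_near hι g.continuous
    (Real.sqrt_pos.2 (by positivity : 0 < ε / (4 * (M + 1))))
  have hpc := continuous_of_mem_polySpace hι.continuous hp
  refine ⟨n, p, hp, ?_⟩
  have hgL' : MemLp g 2 μ := memLp_of_continuous g.continuous
  have hfg : Integrable (fun x => (f x - g x) * (f x - g x)) μ := integrable_mul_self (hf.sub hgL')
  have hfp : Integrable (fun x => (f x - p x) * (f x - p x)) μ :=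
    integrable_mul_self (hf.sub (memLp_of_continuous hpc))
  have h1 : ∫ x, (f x - g x) * (f x - g x) ∂μ ≤ ε / 4 := by
    have h0 : ∀ x, ‖f x - g x‖ ^ (2 : ℝ) = (f x - g x) * (f x - g x) := fun x => by
      rw [Real.rpow_two, Real.norm_eq_abs, sq_abs, pow_two]
    simpa only [h0] using hg
  calc ∫ x, (f x - p x) * (f x - p x) ∂μ
      ≤ ∫ x, (2 * ((f x - g x) * (f x - g x)) + 2 * (ε / (4 * (M + 1)))) ∂μ := by
        refine integral_mono hfp ((hfg.const_mul 2).add (integrable_const _)) fun x => ?_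
        have h2 := sq_lt_sq' (abs_lt.1 (hpg x)).1 (abs_lt.1 (hpg x)).2
        rw [Real.sq_sqrt (by positivity)] at h2
        change (f x - p x) * (f x - p x) ≤ 2 * ((f x - g x) * (f x - g x)) + _
        nlinarith [sq_nonneg ((f x - g x) + (p x - g x))]
    _ = 2 * ∫ x, (f x - g x) * (f x - g x) ∂μ + M * (2 * (ε / (4 * (M + 1)))) := by
        rw [integral_add (hfg.const_mul 2) (integrable_const _), integral_const_mul,
          integral_const, smul_eq_mul]
    _ ≤ ε := by
        have h3 : M * (2 * (ε / (4 * (M + 1)))) ≤ ε / 2 := by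
          have : M * (2 * (ε / (4 * (M + 1)))) = ε / 2 * (M / (M + 1)) := by
            field_simp; norm_num
          rw [this]
          exact mul_le_of_le_one_right (by positivity)
            ((div_le_one (by positivity)).2 (by linarith))
        linarith

omit [CompactSpace Ω] [BorelSpace Ω] [IsFiniteMeasure μ] in
theorem continuous_of_mem_orthoPoly (hι : Continuous ι) {n : ℕ} {f : Ω → ℝ}
    (hf : f ∈ orthoPoly ι μ n) : Continuous f :=
  continuous_of_mem_polySpace hι hf.1

theorem const_mul_mem_orthoPoly (hι : Continuous ι) {n : ℕ} {f : Ω → ℝ}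
    (hf : f ∈ orthoPoly ι μ n) (c : ℝ) : (fun x => c * f x) ∈ orthoPoly ι μ n :=
  (orthoSubmodule hι μ n).smul_mem c hf

omit [MetricSpace Ω] [CompactSpace Ω] [BorelSpace Ω] [IsFiniteMeasure μ] in
theorem sum_mem_polySpace {n : ℕ} {p : ℕ → Ω → ℝ} (hp : ∀ k, p k ∈ orthoPoly ι μ k) :
    (fun x => ∑ k ∈ Finset.range (n + 1), p k x) ∈ polySpace ι n := by
  have : (fun x => ∑ k ∈ Finset.range (n + 1), p k x) = ∑ k ∈ Finset.range (n + 1), p k := by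
    ext x; simp
  rw [this]
  exact Submodule.sum_mem _ fun k hk =>
    polySpace_mono (Nat.lt_succ_iff.1 (Finset.mem_range.1 hk)) (hp k).1

theorem integral_sum_mul_sum (hι : Continuous ι) (M : ℕ) {p g : ℕ → Ω → ℝ}
    (hp : ∀ k, p k ∈ orthoPoly ι μ k) (hg : ∀ k, g k ∈ orthoPoly ι μ k) :
    ∫ x, (∑ k ∈ Finset.range M, p k x) * (∑ k ∈ Finset.range M, g k x) ∂μ =
      ∑ k ∈ Finset.range M, ∫ x, p k x * g k x ∂μ := by
  have hpc := fun k => continuous_of_mem_orthoPoly hι (hp k)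
  have hgc := fun k => continuous_of_mem_orthoPoly hι (hg k)
  simp only [Finset.sum_mul_sum]
  rw [integral_finsetSum _ fun k _ => integrable_finsetSum _ fun l _ =>
    integrable_continuous_mul (hpc k) (hgc l)]
  refine Finset.sum_congr rfl fun k hk => ?_
  rw [integral_finsetSum _ fun l _ => integrable_continuous_mul (hpc k) (hgc l)]
  exact Finset.sum_eq_single_of_mem k hk fun l _ hl =>
    integral_mul_eq_zero_of_ne hl.symm (hp k) (hg l)

variable [μ.IsOpenPosMeasure]

/-- This expansion of the square yields Bessel's inequality, the approximation bound behind
Parseval, and the error of the frame expansion, for different choices of `p`. -/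
theorem integral_sub_sum_mul_self (hι : Continuous ι) (M : ℕ) {f : Ω → ℝ} (hf : MemLp f 2 μ)
    {p : ℕ → Ω → ℝ} (hp : ∀ k, p k ∈ orthoPoly ι μ k) :
    ∫ x, (f x - ∑ k ∈ Finset.range M, p k x) * (f x - ∑ k ∈ Finset.range M, p k x) ∂μ =
      ∫ x, f x * f x ∂μ - ∑ k ∈ Finset.range M,
        (2 * ∫ x, polyProj ι μ k f x * p k x ∂μ - ∫ x, p k x * p k x ∂μ) := by
  have hpc := fun k => continuous_of_mem_orthoPoly hι (hp k)
  have hf1 : Integrable f μ := hf.integrable one_le_two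
  have hSc : Continuous fun x => ∑ k ∈ Finset.range M, p k x :=
    continuous_finsetSum _ fun k _ => hpc k
  have h1 : ∀ x, (f x - ∑ k ∈ Finset.range M, p k x) * (f x - ∑ k ∈ Finset.range M, p k x) =
      f x * f x - 2 * (f x * ∑ k ∈ Finset.range M, p k x) +
        (∑ k ∈ Finset.range M, p k x) * (∑ k ∈ Finset.range M, p k x) := fun x => by ring
  have h2 : ∫ x, f x * ∑ k ∈ Finset.range M, p k x ∂μ =
      ∑ k ∈ Finset.range M, ∫ x, polyProj ι μ k f x * p k x ∂μ := by
    simp only [Finset.mul_sum]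
    rw [integral_finsetSum _ fun k _ => integrable_mul_continuous hf1 (hpc k)]
    exact Finset.sum_congr rfl fun k _ => (integral_polyProj_mul hι hf1 (hp k)).symm
  have hi := (integrable_mul_continuous hf1 hSc).const_mul 2
  have hfi : Integrable (fun x => f x * f x - 2 * (f x * ∑ k ∈ Finset.range M, p k x)) μ :=
    (integrable_mul_self hf).sub hi
  simp only [h1]
  rw [integral_add hfi (integrable_continuous_mul hSc hSc),
    integral_sub (integrable_mul_self hf) hi, integral_const_mul, h2,
    integral_sum_mul_sum hι M hp hp, Finset.sum_sub_distrib, ← Finset.mul_sum]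
  ring

/-- The squared `L²` norm of the component of `f` in `V_n(Ω, μ)`. -/
noncomputable def projNormSq (ι : Ω → EuclideanSpace ℝ (Fin d)) (μ : Measure Ω) (f : Ω → ℝ)
    (n : ℕ) : ℝ :=
  ∫ x, polyProj ι μ n f x * polyProj ι μ n f x ∂μ

omit [MetricSpace Ω] [CompactSpace Ω] [BorelSpace Ω] [IsFiniteMeasure μ] [μ.IsOpenPosMeasure] in
theorem projNormSq_nonneg (f : Ω → ℝ) (n : ℕ) : 0 ≤ projNormSq ι μ f n :=
  integral_nonneg fun _ => mul_self_nonneg _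

theorem integral_sub_sum_polyProj_mul_self (hι : Continuous ι) (M : ℕ) {f : Ω → ℝ}
    (hf : MemLp f 2 μ) (b : ℕ → ℝ) :
    ∫ x, (f x - ∑ k ∈ Finset.range M, b k * polyProj ι μ k f x) *
      (f x - ∑ k ∈ Finset.range M, b k * polyProj ι μ k f x) ∂μ =
      ∫ x, f x * f x ∂μ - ∑ k ∈ Finset.range M, (2 * b k - b k ^ 2) * projNormSq ι μ f k := by
  rw [integral_sub_sum_mul_self hι M hf fun k =>
    const_mul_mem_orthoPoly hι (polyProj_mem hι k (hf.integrable one_le_two)) (b k)]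
  congr 1
  refine Finset.sum_congr rfl fun k _ => ?_
  have h1 : ∀ x, polyProj ι μ k f x * (b k * polyProj ι μ k f x) =
    b k * (polyProj ι μ k f x * polyProj ι μ k f x) := fun x => by ring
  have h2 : ∀ x, b k * polyProj ι μ k f x * (b k * polyProj ι μ k f x) =
    b k ^ 2 * (polyProj ι μ k f x * polyProj ι μ k f x) := fun x => by ring
  simp only [h1, h2, integral_const_mul]
  unfold projNormSq
  ring

theorem sum_projNormSq_le (hι : Continuous ι) (M : ℕ) {f : Ω → ℝ} (hf : MemLp f 2 μ) :
    ∑ k ∈ Finset.range M, projNormSq ι μ f k ≤ ∫ x, f x * f x ∂μ := by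
  have h := integral_sub_sum_polyProj_mul_self hι M hf fun _ => 1
  have h0 : 0 ≤ ∫ x, (f x - ∑ k ∈ Finset.range M, 1 * polyProj ι μ k f x) *
      (f x - ∑ k ∈ Finset.range M, 1 * polyProj ι μ k f x) ∂μ :=
    integral_nonneg fun x => mul_self_nonneg _
  rw [h] at h0
  norm_num at h0
  linarith

/-- Parseval's identity for the expansion into orthogonal polynomials. -/
theorem tendsto_sum_projNormSq (hι : IsEmbedding ι) {f : Ω → ℝ} (hf : MemLp f 2 μ) :
    Tendsto (fun M => ∑ k ∈ Finset.range M, projNormSq ι μ f k) atTop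
      (𝓝 (∫ x, f x * f x ∂μ)) := by
  refine Metric.tendsto_atTop.2 fun ε hε => ?_
  have hf1 := hf.integrable one_le_two
  obtain ⟨n, p, hp, hle⟩ := exists_polySpace_integral_le hι hf (half_pos hε)
  obtain ⟨g, hg, hsum⟩ := exists_sum_orthoPoly (μ := μ) hι.continuous n hp
  simp only [hsum] at hle
  rw [integral_sub_sum_mul_self hι.continuous (n + 1) hf hg] at hle
  -- Termwise, `2⟨P_k f, g_k⟩ - ‖g_k‖² ≤ ‖P_k f‖²`: orthogonal projections are best approximations.
  have h1 : ∑ k ∈ Finset.range (n + 1),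
      (2 * ∫ x, polyProj ι μ k f x * g k x ∂μ - ∫ x, g k x * g k x ∂μ) ≤
      ∑ k ∈ Finset.range (n + 1), projNormSq ι μ f k := by
    refine Finset.sum_le_sum fun k _ => ?_
    have hPc := continuous_polyProj hι.continuous k hf1
    have hgc := continuous_of_mem_orthoPoly hι.continuous (hg k)
    unfold projNormSq
    rw [← integral_const_mul, ← integral_sub ((integrable_continuous_mul hPc hgc).const_mul 2)
      (integrable_continuous_mul hgc hgc)]
    refine integral_mono (((integrable_continuous_mul hPc hgc).const_mul 2).sub
      (integrable_continuous_mul hgc hgc)) (integrable_continuous_mul hPc hPc) fun x => ?_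
    change 2 * (polyProj ι μ k f x * g k x) - g k x * g k x ≤ _
    nlinarith [sq_nonneg (polyProj ι μ k f x - g k x)]
  refine ⟨n + 1, fun M hM => ?_⟩
  have h2 := Finset.sum_le_sum_of_subset_of_nonneg (Finset.range_mono hM)
    (fun k _ _ => projNormSq_nonneg (ι := ι) (μ := μ) f k)
  have h3 := sum_projNormSq_le hι.continuous M hf
  rw [Real.dist_eq, abs_lt]
  constructor <;> linarith

end Expansion

/-! ### Frames -/

section CutoffSums

variable {a : ℝ → ℝ}

/-- The support of a continuous function is open, hence lies in the interior of `[1/2, 2]`; this is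
why the endpoints are included. -/
theorem IsFrameCutoff.eq_zero_of_le (ha : IsFrameCutoff a) {t : ℝ} (ht : t ≤ 1 / 2 ∨ 2 ≤ t) :
    a t = 0 := by
  by_contra h
  have h1 : Function.support a ⊆ interior (Set.Icc (1 / 2) 2) :=
    interior_maximal ((subset_tsupport a).trans ha.2.2.1) ha.1.continuous.isOpen_support
  have h2 := h1 (Function.mem_support.2 h)
  rw [interior_Icc] at h2
  rcases ht with ht | ht
  · exact ht.not_gt h2.1
  · exact ht.not_gt h2.2

theorem IsFrameCutoff.sq_le_one (ha : IsFrameCutoff a) (t : ℝ) : a t ^ 2 ≤ 1 := by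
  rcases le_or_gt t (1 / 2) with h1 | h1
  · rw [ha.eq_zero_of_le (Or.inl h1)]; norm_num
  rcases le_or_gt 2 t with h2 | h2
  · rw [ha.eq_zero_of_le (Or.inr h2)]; norm_num
  rcases le_total t 1 with h3 | h3
  · have := ha.2.2.2.2 t ⟨h1.le, h3⟩
    nlinarith [sq_nonneg (a (2 * t))]
  · have := ha.2.2.2.2 (t / 2) ⟨by linarith, by linarith⟩
    rw [mul_div_cancel₀ _ two_ne_zero] at this
    nlinarith [sq_nonneg (a (t / 2))]

/-- The coefficient of the reproducing kernel of degree `k` in `F_j`. -/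
noncomputable def frameCoeff (a : ℝ → ℝ) : ℕ → ℕ → ℝ
  | 0, k => if k = 0 then 1 else 0
  | j + 1, k => a ((k : ℝ) / 2 ^ j)

theorem IsFrameCutoff.frameCoeff_eq_zero (ha : IsFrameCutoff a) {j k : ℕ} (h : 2 ^ j < k) :
    frameCoeff a j k = 0 := by
  cases j with
  | zero => exact if_neg (by rw [pow_zero] at h; omega)
  | succ j =>
    refine ha.eq_zero_of_le (Or.inr ?_)
    rw [le_div_iff₀ (by positivity), ← pow_succ']
    exact_mod_cast h.le

/-- At most two consecutive dyadic levels meet a given `k ≥ 1`, and their squares sum to `1` by the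
cut-off identity; in a truncated sum only the last level may lack its partner. Degree `0` is covered
by `F_0` alone, since `a 0 = 0`. -/
theorem IsFrameCutoff.sum_frameCoeff_sq (ha : IsFrameCutoff a) (r k : ℕ) :
    ∑ j ∈ Finset.range (r + 2), frameCoeff a j k ^ 2 =
      if k ≤ 2 ^ r then 1 else a ((k : ℝ) / 2 ^ r) ^ 2 := by
  induction r with
  | zero =>
    have h0 : a 0 = 0 := ha.eq_zero_of_le (Or.inl (by norm_num))
    have h2 : a 2 = 0 := ha.eq_zero_of_le (Or.inr le_rfl)
    have h1 : a 1 ^ 2 = 1 := by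
      have := ha.2.2.2.2 1 ⟨by norm_num, le_rfl⟩
      rwa [mul_one, h2, zero_pow two_ne_zero, add_zero] at this
    rw [Finset.sum_range_succ, Finset.sum_range_one]
    simp only [frameCoeff, pow_zero, div_one]
    rcases Nat.eq_zero_or_pos k with rfl | hk
    · simp [h0]
    · rw [if_neg hk.ne', zero_pow two_ne_zero, zero_add]
      split_ifs with h
      · rw [show k = 1 by omega, Nat.cast_one, h1]
      · rfl
  | succ r ih =>
    rw [Finset.sum_range_succ, ih]
    change _ + a ((k : ℝ) / 2 ^ (r + 1)) ^ 2 = _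
    have h2t : (k : ℝ) / 2 ^ r = 2 * ((k : ℝ) / 2 ^ (r + 1)) := by rw [pow_succ]; field_simp
    rw [h2t]
    set t := (k : ℝ) / 2 ^ (r + 1) with ht
    have hiff1 : k ≤ 2 ^ r ↔ t ≤ 1 / 2 := by
      rw [ht, div_le_iff₀ (by positivity), pow_succ', one_div, inv_mul_cancel_left₀ two_ne_zero]
      exact_mod_cast Iff.rfl
    have hiff2 : k ≤ 2 ^ (r + 1) ↔ t ≤ 1 := by
      rw [ht, div_le_one (by positivity)]
      exact_mod_cast Iff.rfl
    simp only [hiff1, hiff2]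
    rcases le_or_gt t (1 / 2) with h1 | h1
    · rw [if_pos h1, if_pos (by linarith), ha.eq_zero_of_le (Or.inl h1)]
      norm_num
    · rw [if_neg h1.not_ge]
      rcases le_or_gt t 1 with h3 | h3
      · rw [if_pos h3, add_comm]
        exact ha.2.2.2.2 t ⟨h1.le, h3⟩
      · rw [if_neg h3.not_ge, ha.eq_zero_of_le (Or.inr (by linarith : 2 ≤ 2 * t))]
        norm_num

theorem IsFrameCutoff.sum_frameCoeff_sq_le_one (ha : IsFrameCutoff a) (R k : ℕ) :
    ∑ j ∈ Finset.range R, frameCoeff a j k ^ 2 ≤ 1 := by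
  calc ∑ j ∈ Finset.range R, frameCoeff a j k ^ 2
      ≤ ∑ j ∈ Finset.range (R + 2), frameCoeff a j k ^ 2 :=
        Finset.sum_le_sum_of_subset_of_nonneg (Finset.range_mono (by omega))
          fun j _ _ => sq_nonneg _
    _ ≤ 1 := by
        rw [ha.sum_frameCoeff_sq]
        split_ifs
        · exact le_rfl
        · exact ha.sq_le_one _

end CutoffSums

/-! ### Discretization of the frame kernels by cubature. -/

section Frame

variable {Ω : Type*} [MetricSpace Ω] [CompactSpace Ω] [MeasurableSpace Ω] [BorelSpace Ω]
  {d : ℕ} {ι : Ω → EuclideanSpace ℝ (Fin d)} {μ : Measure Ω} [IsFiniteMeasure μ]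
  [μ.IsOpenPosMeasure] {a : ℝ → ℝ}

theorem reproKernel_zero (hι : Continuous ι) (hμ : μ.real Set.univ = 1) (x y : Ω) :
    reproKernel ι μ 0 x y = 1 := by
  obtain ⟨p, hp, hpe⟩ := mem_polySpace.1 (reproKernel_mem (μ := μ) hι 0 x).1
  obtain ⟨c, rfl⟩ : ∃ c, p = MvPolynomial.C c :=
    ⟨_, MvPolynomial.totalDegree_eq_zero_iff_eq_C.1 (Nat.le_zero.1 hp)⟩
  have h1 : (fun _ : Ω => (1 : ℝ)) ∈ orthoPoly ι μ 0 := ⟨const_mem_polySpace 1 0, by simp⟩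
  have h2 := (isReproducingKernel_reproKernel (μ := μ) hι 0).2 _ h1 x
  simp only [hpe, MvPolynomial.eval_C, one_mul] at h2 ⊢
  rwa [integral_const, hμ, one_smul] at h2

theorem IsFrameCutoff.frameKernel_eq (ha : IsFrameCutoff a) (hι : Continuous ι)
    (hμ : μ.real Set.univ = 1) (j : ℕ) (x y : Ω) :
    frameKernel ι μ a j x y =
      ∑ k ∈ Finset.range (2 ^ j + 1), frameCoeff a j k * reproKernel ι μ k x y := by
  cases j with
  | zero =>
    simp [frameKernel, frameCoeff, reproKernel_zero hι hμ]
  | succ j =>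
    rw [frameKernel, locKernel_eq_sum (fun t ht => ha.eq_zero_of_le (Or.inr ht.le))
      Nat.one_le_two_pow, pow_succ']
    simp [frameCoeff]

theorem IsFrameCutoff.frameKernel_comm (ha : IsFrameCutoff a) (hι : Continuous ι)
    (hμ : μ.real Set.univ = 1) (j : ℕ) (x y : Ω) :
    frameKernel ι μ a j x y = frameKernel ι μ a j y x := by
  simp only [ha.frameKernel_eq hι hμ, reproKernel_comm hι _ x y]

theorem IsFrameCutoff.continuous_frameKernel (ha : IsFrameCutoff a) (hι : Continuous ι)
    (hμ : μ.real Set.univ = 1) (j : ℕ) (x : Ω) : Continuous (frameKernel ι μ a j x) := by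
  rw [show frameKernel ι μ a j x = _ from funext fun y => ha.frameKernel_eq hι hμ j x y]
  exact continuous_finsetSum _ fun k _ => continuous_const.mul (continuous_reproKernel hι k x)

theorem IsFrameCutoff.memLp_needlet (ha : IsFrameCutoff a) (hι : Continuous ι)
    (hμ : μ.real Set.univ = 1) (lam : ℕ → Ω → ℝ) (j : ℕ) (z : Ω) :
    MemLp (needlet ι μ a lam j z) 2 μ := by
  refine memLp_of_continuous ?_
  unfold needlet
  simp only [ha.frameKernel_comm hι hμ j _ z]
  exact continuous_const.mul (ha.continuous_frameKernel hι hμ j z)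

/-- The convolution of `f` with `F_j`. -/
noncomputable def frameProj (ι : Ω → EuclideanSpace ℝ (Fin d)) (μ : Measure Ω) (a : ℝ → ℝ)
    (j : ℕ) (f : Ω → ℝ) (x : Ω) : ℝ :=
  ∑ k ∈ Finset.range (2 ^ j + 1), frameCoeff a j k * polyProj ι μ k f x

theorem IsFrameCutoff.integral_mul_needlet (ha : IsFrameCutoff a) (hι : Continuous ι)
    (hμ : μ.real Set.univ = 1) (lam : ℕ → Ω → ℝ) (j : ℕ) (z : Ω) {f : Ω → ℝ}
    (hf : Integrable f μ) :
    ∫ y, f y * needlet ι μ a lam j z y ∂μ = √(lam j z) * frameProj ι μ a j f z := by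
  unfold needlet frameProj polyProj
  simp only [ha.frameKernel_comm hι hμ j _ z, mul_left_comm (f _)]
  rw [integral_const_mul]
  congr 1
  simp only [ha.frameKernel_eq hι hμ, Finset.mul_sum, mul_left_comm (f _)]
  rw [integral_finsetSum _ fun k _ => (integrable_mul_continuous hf
    (continuous_reproKernel hι k z)).const_mul _]
  simp only [integral_const_mul]

variable {Ξ : Finset Ω} {lam : ℕ → Ω → ℝ} {j : ℕ}

theorem IsFrameCutoff.sum_range_sq_mul (ha : IsFrameCutoff a) {j M : ℕ} (hM : 2 ^ j + 1 ≤ M)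
    (v : ℕ → ℝ) :
    ∑ k ∈ Finset.range (2 ^ j + 1), frameCoeff a j k ^ 2 * v k =
      ∑ k ∈ Finset.range M, frameCoeff a j k ^ 2 * v k := by
  refine Finset.sum_subset (Finset.range_mono hM) fun k _ hk => ?_
  rw [ha.frameCoeff_eq_zero (by simpa using hk)]
  simp

/-- The free bound `M` lets several levels `j` share one range of degrees, so that sums over `j` and
`k` can be interchanged. -/
theorem IsFrameCutoff.sum_sq_integral_mul_needlet (ha : IsFrameCutoff a) (hι : Continuous ι)
    (hμ : μ.real Set.univ = 1) (hlam : ∀ z ∈ Ξ, 0 < lam j z)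
    (hcub : ∀ f ∈ polySpace ι (2 ^ (j + 1)), ∫ x, f x ∂μ = ∑ z ∈ Ξ, lam j z * f z)
    {M : ℕ} (hM : 2 ^ j + 1 ≤ M) {f : Ω → ℝ} (hf : Integrable f μ) :
    ∑ z ∈ Ξ, |∫ y, f y * needlet ι μ a lam j z y ∂μ| ^ 2 =
      ∑ k ∈ Finset.range M, frameCoeff a j k ^ 2 * projNormSq ι μ f k := by
  have hmem : ∀ k, (fun x => frameCoeff a j k * polyProj ι μ k f x) ∈ orthoPoly ι μ k := fun k =>
    const_mul_mem_orthoPoly hι (polyProj_mem hι k hf) _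
  have hG : frameProj ι μ a j f ∈ polySpace ι (2 ^ j) := sum_mem_polySpace hmem
  have hGG := mul_mem_polySpace hG hG
  -- The square has degree `2 ^ (j + 1)`, exactly the degree of exactness of the cubature.
  rw [← two_mul, ← pow_succ'] at hGG
  have h1 : ∑ z ∈ Ξ, |∫ y, f y * needlet ι μ a lam j z y ∂μ| ^ 2 =
      ∑ z ∈ Ξ, lam j z * (frameProj ι μ a j f z * frameProj ι μ a j f z) := by
    refine Finset.sum_congr rfl fun z hz => ?_
    rw [ha.integral_mul_needlet hι hμ lam j z hf, sq_abs, mul_pow, Real.sq_sqrt (hlam z hz).le,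
      pow_two]
  rw [h1, ← hcub _ hGG, ← ha.sum_range_sq_mul hM]
  unfold frameProj
  rw [integral_sum_mul_sum hι _ hmem hmem]
  refine Finset.sum_congr rfl fun k _ => ?_
  rw [projNormSq, ← integral_const_mul]
  exact integral_congr_ae (Eventually.of_forall fun x => by ring)

theorem IsFrameCutoff.sum_integral_mul_needlet_mul (ha : IsFrameCutoff a) (hι : Continuous ι)
    (hμ : μ.real Set.univ = 1) (hlam : ∀ z ∈ Ξ, 0 < lam j z)
    (hcub : ∀ f ∈ polySpace ι (2 ^ (j + 1)), ∫ x, f x ∂μ = ∑ z ∈ Ξ, lam j z * f z)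
    {M : ℕ} (hM : 2 ^ j + 1 ≤ M) {f : Ω → ℝ} (hf : Integrable f μ) (x : Ω) :
    ∑ z ∈ Ξ, (∫ y, f y * needlet ι μ a lam j z y ∂μ) * needlet ι μ a lam j z x =
      ∑ k ∈ Finset.range M, frameCoeff a j k ^ 2 * polyProj ι μ k f x := by
  have hmem : ∀ k, (fun x => frameCoeff a j k * polyProj ι μ k f x) ∈ orthoPoly ι μ k := fun k =>
    const_mul_mem_orthoPoly hι (polyProj_mem hι k hf) _
  have hmem' : ∀ k, (fun y => frameCoeff a j k * reproKernel ι μ k x y) ∈ orthoPoly ι μ k :=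
    fun k => const_mul_mem_orthoPoly hι (reproKernel_mem hι k x) _
  have hF : frameKernel ι μ a j x =
      fun y => ∑ k ∈ Finset.range (2 ^ j + 1), frameCoeff a j k * reproKernel ι μ k x y :=
    funext fun y => ha.frameKernel_eq hι hμ j x y
  have hG : frameProj ι μ a j f ∈ polySpace ι (2 ^ j) := sum_mem_polySpace hmem
  have hF' : frameKernel ι μ a j x ∈ polySpace ι (2 ^ j) := by
    rw [hF]; exact sum_mem_polySpace hmem'
  have hGF := mul_mem_polySpace hG hF'
  rw [← two_mul, ← pow_succ'] at hGF
  have h1 : ∑ z ∈ Ξ, (∫ y, f y * needlet ι μ a lam j z y ∂μ) * needlet ι μ a lam j z x =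
      ∑ z ∈ Ξ, lam j z * (frameProj ι μ a j f z * frameKernel ι μ a j x z) := by
    refine Finset.sum_congr rfl fun z hz => ?_
    rw [ha.integral_mul_needlet hι hμ lam j z hf, needlet]
    calc _ = (√(lam j z) * √(lam j z)) * (frameProj ι μ a j f z * frameKernel ι μ a j x z) := by
          ring
      _ = _ := by rw [Real.mul_self_sqrt (hlam z hz).le]
  rw [h1, ← hcub _ hGF, ← ha.sum_range_sq_mul hM, hF]
  unfold frameProj
  rw [integral_sum_mul_sum hι _ hmem hmem']
  refine Finset.sum_congr rfl fun k _ => ?_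
  have h2 := (isReproducingKernel_reproKernel (μ := μ) hι k).2 _ (polyProj_mem hι k hf) x
  rw [← h2, ← integral_const_mul]
  exact integral_congr_ae (Eventually.of_forall fun y => by ring)

/-- Positive cubature rules lead to tight frames. -/
theorem IsFrameCutoff.isTightFrame (ha : IsFrameCutoff a) (hι : IsEmbedding ι)
    (hμ : μ.real Set.univ = 1) {Ξ : ℕ → Finset Ω} {lam : ℕ → Ω → ℝ}
    (hlam : ∀ j, ∀ z ∈ Ξ j, 0 < lam j z)
    (hcub : ∀ j, ∀ f ∈ polySpace ι (2 ^ (j + 1)), ∫ x, f x ∂μ = ∑ z ∈ Ξ j, lam j z * f z) :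
    IsTightFrame μ Ξ (needlet ι μ a lam) := by
  have hιc := hι.continuous
  refine ⟨fun j z _ => ha.memLp_needlet hιc hμ lam j z, fun f hf => ?_⟩
  have hf1 := hf.integrable one_le_two
  set E := ∫ x, f x * f x ∂μ with hE
  have hE0 : 0 ≤ E := integral_nonneg fun x => mul_self_nonneg _
  set q := projNormSq ι μ f with hq
  have hq0 : ∀ k, 0 ≤ q k := projNormSq_nonneg f
  set β : ℕ → ℕ → ℝ := fun R k => ∑ j ∈ Finset.range R, frameCoeff a j k ^ 2 with hβ
  have hβ0 : ∀ R k, 0 ≤ β R k := fun R k => Finset.sum_nonneg fun j _ => sq_nonneg _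
  have hβ1 : ∀ R k, β R k ≤ 1 := ha.sum_frameCoeff_sq_le_one
  have hpow : ∀ {R j}, j ∈ Finset.range R → 2 ^ j + 1 ≤ 2 ^ R + 1 := fun hj =>
    Nat.succ_le_succ (Nat.pow_le_pow_right two_pos (Finset.mem_range.1 hj).le)
  have hS : ∀ R x, ∑ j ∈ Finset.range R, ∑ z ∈ Ξ j,
      (∫ y, f y * needlet ι μ a lam j z y ∂μ) * needlet ι μ a lam j z x =
      ∑ k ∈ Finset.range (2 ^ R + 1), β R k * polyProj ι μ k f x := by
    intro R x
    rw [Finset.sum_congr rfl fun j hj =>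
      ha.sum_integral_mul_needlet_mul hιc hμ (hlam j) (hcub j) (hpow hj) hf1 x, Finset.sum_comm]
    simp only [hβ, Finset.sum_mul]
  have hT : ∀ R, ∑ j ∈ Finset.range R, ∑ z ∈ Ξ j,
      |∫ y, f y * needlet ι μ a lam j z y ∂μ| ^ 2 =
      ∑ k ∈ Finset.range (2 ^ R + 1), β R k * q k := by
    intro R
    rw [Finset.sum_congr rfl fun j hj =>
      ha.sum_sq_integral_mul_needlet hιc hμ (hlam j) (hcub j) (hpow hj) hf1, Finset.sum_comm]
    simp only [hβ, Finset.sum_mul, hq]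
  -- Squeeze: `β (r + 2) k = 1` for `k ≤ 2 ^ r` and `β ≤ 1` always, so the sums lie between partial
  -- Parseval sums and `E`.
  have hlim : Tendsto (fun R => ∑ k ∈ Finset.range (2 ^ R + 1), β R k * q k) atTop (𝓝 E) := by
    rw [← tendsto_add_atTop_iff_nat 2]
    refine tendsto_of_tendsto_of_tendsto_of_le_of_le
      (g := fun r => ∑ k ∈ Finset.range (2 ^ r + 1), q k) (h := fun _ => E) ?_
      tendsto_const_nhds (fun r => ?_) (fun r => ?_)
    · refine (tendsto_sum_projNormSq hι hf).comp (tendsto_atTop_mono (fun r => ?_) tendsto_id)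
      exact Nat.lt_two_pow_self.le.trans (Nat.le_succ _)
    · calc ∑ k ∈ Finset.range (2 ^ r + 1), q k
          = ∑ k ∈ Finset.range (2 ^ r + 1), β (r + 2) k * q k := by
            refine Finset.sum_congr rfl fun k hk => ?_
            simp only [hβ]
            rw [ha.sum_frameCoeff_sq, if_pos (Nat.lt_succ_iff.1 (Finset.mem_range.1 hk)), one_mul]
        _ ≤ _ := Finset.sum_le_sum_of_subset_of_nonneg
            (Finset.range_mono (Nat.succ_le_succ (Nat.pow_le_pow_right two_pos (by omega))))
            fun k _ _ => mul_nonneg (hβ0 _ k) (hq0 k)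
    · exact (Finset.sum_le_sum fun k _ => mul_le_of_le_one_left (hq0 k) (hβ1 _ k)).trans
        (sum_projNormSq_le hιc _ hf)
  constructor
  · have hSL : ∀ R, MemLp (fun x => f x -
        ∑ k ∈ Finset.range (2 ^ R + 1), β R k * polyProj ι μ k f x) 2 μ := fun R =>
      hf.sub (memLp_of_continuous (continuous_finsetSum _ fun k _ =>
        continuous_const.mul (continuous_polyProj hιc k hf1)))
    simp only [hS, eLpNorm_two_eq (hSL _)]
    rw [← ENNReal.ofReal_zero, ← Real.sqrt_zero]
    refine ENNReal.tendsto_ofReal ((Real.continuous_sqrt.tendsto 0).comp ?_)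
    have hsub : Tendsto (fun R => E - ∑ k ∈ Finset.range (2 ^ R + 1), β R k * q k) atTop (𝓝 0) := by
      simpa using hlim.const_sub E
    refine squeeze_zero (fun R => integral_nonneg fun x => mul_self_nonneg _) (fun R => ?_) hsub
    rw [integral_sub_sum_polyProj_mul_self hιc _ hf]
    refine sub_le_sub_left (Finset.sum_le_sum fun k _ => ?_) _
    refine mul_le_mul_of_nonneg_right ?_ (hq0 k)
    -- Since `0 ≤ β ≤ 1`, one has `β ≤ 2β - β²`; the squared error is thus at most `E - ∑ β q`.
    nlinarith [hβ0 R k, hβ1 R k]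
  · rw [eLpNorm_two_eq hf, ENNReal.toReal_ofReal (Real.sqrt_nonneg _), Real.sq_sqrt hE0,
      hasSum_iff_tendsto_nat_of_nonneg fun j => Finset.sum_nonneg fun z _ => sq_nonneg _]
    simp only [hT]
    exact hlim

end Frame

end LocFrame

theorem mainTheorem1 {d : ℕ} {Ω : Type*} [MetricSpace Ω] [CompactSpace Ω] [MeasurableSpace Ω]
    [BorelSpace Ω] (ι : Ω → EuclideanSpace ℝ (Fin d)) (hι : IsEmbedding ι)
    (m : Measure Ω) [IsFiniteMeasure m] (hm : LocFrame.IsHomogeneousMeasure m)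
    (ϖ : Ω → ℝ) (hϖ : LocFrame.IsLocalizable ι m ϖ)
    (w : Ω → ℝ) (hw : LocFrame.IsDoublingWeight m w) (hw1 : ∫ x, w x ∂m = 1)
    (h4 : LocFrame.Assertion4 ι) :
    ∃ δ₀ : ℝ, 0 < δ₀ ∧ ∀ δ : ℝ, 0 < δ → δ < δ₀ →
      ∃ c₁ c₂ : ℝ, 0 < c₁ ∧ 0 < c₂ ∧
        ∀ Ξ : ℕ → Finset Ω, (∀ j, LocFrame.IsMaximalSeparated (δ / 2 ^ j) (Ξ j)) →
          (∃ lam : ℕ → Ω → ℝ, ∀ j,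
            LocFrame.IsPositiveCubature ι m w (2 ^ (j + 1)) (Ξ j) (lam j) ∧
            ∀ z ∈ Ξ j, c₁ * LocFrame.wmass m w (ball z (1 / 2 ^ j)) ≤ lam j z ∧
              lam j z ≤ c₂ * LocFrame.wmass m w (ball z (1 / 2 ^ j))) ∧
          ∀ lam : ℕ → Ω → ℝ,
            (∀ j, LocFrame.IsPositiveCubature ι m w (2 ^ (j + 1)) (Ξ j) (lam j)) →
            ∀ a : ℝ → ℝ, LocFrame.IsFrameCutoff a →
              LocFrame.IsTightFrame (LocFrame.weightMeasure m w) Ξ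
                (LocFrame.needlet ι (LocFrame.weightMeasure m w) a lam) := by
  open LocFrame in
  have := isFiniteMeasure_weightMeasure hw.integrable
  have := hw.isOpenPosMeasure hw1
  have hint := integral_weightMeasure hw.integrable hw.nonneg
  have hmass : ∀ z r, (weightMeasure m w).real (ball z r) = wmass m w (ball z r) := fun z r =>
    weightMeasure_real hw.integrable hw.nonneg measurableSet_ball
  have huniv : (weightMeasure m w).real Set.univ = 1 := by
    rw [weightMeasure_real hw.integrable hw.nonneg MeasurableSet.univ, wmass, setIntegral_univ, hw1]
  obtain ⟨L, hL⟩ := hw.doublingMeasure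
  obtain ⟨δ₀, hδ₀, hcub⟩ := hϖ.exists_cubature hι.continuous hL
  obtain ⟨c₂, hc₂, hupper⟩ := exists_weight_le hι.continuous h4 hL
  -- At level `j` the degree times the separation is `2 ^ (j + 1) * (δ / 2 ^ j) = 2 * δ`.
  refine ⟨δ₀ / 2, half_pos hδ₀, fun δ hδ hδδ₀ => ?_⟩
  -- The factor `δ / 2` passes from the balls of radius `δ / 2 ^ j / 2` in the lower bound to those
  -- of radius `1 / 2 ^ j`.
  obtain ⟨C, hC, hball⟩ := hL.exists_ball_le (half_pos hδ)
  refine ⟨1 / 2 * C⁻¹, c₂, by positivity, hc₂, fun Ξ hΞ => ⟨?_, fun lam hlam a ha => ?_⟩⟩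
  · have hex : ∀ j, ∃ lam : Ω → ℝ,
        (∀ z ∈ Ξ j, 1 / 2 * (weightMeasure m w).real (ball z (δ / 2 ^ j / 2)) ≤ lam z) ∧
        ∀ f ∈ polySpace ι (2 ^ (j + 1)), ∫ x, f x ∂(weightMeasure m w) = ∑ z ∈ Ξ j, lam z * f z :=
      fun j => hcub (2 ^ (j + 1)) (δ / 2 ^ j) (Ξ j) Nat.one_le_two_pow (by positivity) (by
        push_cast
        rw [pow_succ']
        field_simp
        linarith) (hΞ j)
    choose lam hlow hlam using hex
    have hpos : ∀ j, ∀ z ∈ Ξ j, 0 < lam j z := fun j z hz =>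
      lt_of_lt_of_le (mul_pos one_half_pos (measureReal_ball_pos z (by positivity))) (hlow j z hz)
    refine ⟨lam, fun j => ⟨⟨hpos j, fun f hf => ?_⟩, fun z hz => ⟨?_, ?_⟩⟩⟩
    · rw [← hint, hlam j f hf]
    · refine le_trans ?_ (hlow j z hz)
      have h1 := hball z (1 / 2 ^ j) (by positivity)
      rw [show δ / 2 * (1 / 2 ^ j) = δ / 2 ^ j / 2 by ring] at h1
      rw [← hmass, mul_assoc]
      refine mul_le_mul_of_nonneg_left ?_ one_half_pos.le
      rwa [inv_mul_le_iff₀ hC]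
    -- Exactness only in degree `2 ^ j` is used, so that the ball obtained has radius `1 / 2 ^ j`.
    · have h1 := hupper (2 ^ j) (Ξ j) (lam j) Nat.one_le_two_pow (fun z hz => (hpos j z hz).le)
        (fun f hf => hlam j f (polySpace_mono (Nat.pow_le_pow_right two_pos j.le_succ) hf)) z hz
      rw [hmass] at h1
      exact_mod_cast h1
  · exact ha.isTightFrame hι huniv (fun j => (hlam j).1) fun j f hf => by
      rw [hint]
      exact (hlam j).2 f hf
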